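/- **Conventions.** A *prefix machine* is a partial computable function $M(z,y)$ of two binary strings (program $z$, side input $y$) such that for every fixed $y$ the set of $z$ on which $M(\cdot,y)$ halts is prefix-free. A prefix machine $U$ is *universal* if for every prefix machine $M$ there is a string $\sigma$ with $U(\sigma z,y)=M(z,y)$ for all $z,y$. Fix a universal $U$ and let $K(x|y)=\min\{\ell(z): U(z,y)=x\}$ and $K(x)=K(x|\epsilon)$, with $\epsilon$ the empty string. Fix a standard Gödel numbering of the partial computable functions. For a computable partial function $f:\{0,1\}^*\to\{0,1\}^*$ let $K(f)$ be the minimum of $K(c)$ over all indices $c$ of machines computing $f$. A partial function $Q:\{0,1\}^*\to\mathbb R$ is *upper-semicomputable* if some machine, for every $x\in\mathrm{dom}\,Q$, outputs on $(x,0),(x,1),\dots$ a non-increasing sequence of rationals converging to $Q(x)$; it is *computable* if some machine, for every $x\in\mathrm{dom}\,Q$ and $n\in\mathbb N$, outputs on $(x,n)$ a rational within $2^{-n}$ of $Q(x)$. Let $K(Q)$ be the minimum of $K(c)$ over the indices $c$ of machines that upper-semicompute (respectively compute) $Q$, and let $K(Q,f)$ be the minimum of $K(\langle c,d\rangle)$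 over pairs of an index $c$ of a machine that upper-semicomputes $Q$ and an index $d$ of a machine that computes $f$. Let $kT>0$. A *process* on a state space $\mathcal X\subseteq\{0,1\}^*$ consists of transition probabilities $p(y|x)$ and a heat function $Q:\mathcal X\to\mathbb R$. It *obeys the second law* if for every finitely supported initial distribution $p_X$ on $\mathcal X$, with final distribution $p_Y$, $$S(p_Y)-S(p_X)+\langle Q\rangle_{p_X}/kT\ \ge 0 ,$$ where $S$ is Shannon entropy in nats. A *realization* of $f$ is a process that obeys the second law, with $\mathrm{dom}\,f\cup\mathrm{img}\,f\subseteq\mathcal X$, and that takes each $x\in\mathrm{dom}\,f$ to $f(x)$ with probability one. It is called *computable* (*upper-semicomputable*) if $Q/kT$, restricted to $\mathrm{dom}\,f$, is so; below, $K(Q/kT)$ refers to this restriction. **Theorem.** There is a constant $C$, depending only on $U$, such that for every computable partial function $f:\{0,1\}^*\to\{0,1\}^*$ the following hold. 1. Let $Q:\{0,1\}^*\to\mathbb R$ be an upper-semicomputable partial function with $\mathrm{dom}\,Q\supseteq\mathrm{dom}\,f$ and $\sum_{x:f(x)=y}e^{-Q(x)}\le 1$ for every $y\in\mathrm{img}\,f$.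 Then for every $x\in\mathrm{dom}\,f$, $$Q(x)\ \ge\ \ln 2\,\bigl[K(x|f(x))-K(Q,f)\bigr]-C .$$ 2. For every $kT>0$ and every $\mathcal X\subseteq\{0,1\}^*$ that contains $\mathrm{dom}\,f\cup\mathrm{img}\,f$, there is a realization of $f$ on $\mathcal X$ (the *dominating realization*) whose heat function satisfies $Q_{\mathrm{dom}}(x)=kT\ln 2\cdot K(x|f(x))$ for all $x\in\mathrm{dom}\,f$. 3. For every $kT>0$ and every computable realization of $f$, with heat function $Q$, for every $x\in\mathrm{dom}\,f$, $$Q(x)\ \ge\ Q_{\mathrm{dom}}(x)-kT\ln 2\,\bigl(K(Q/kT)+K(f)\bigr)-kT\,C .$$ The same holds for every upper-semicomputable realization, with $K(Q/kT)$ the complexity of upper-semicomputing $Q/kT$. -/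

import Mathlib

open scoped ENNReal Topology
open Filter

/-- Finite binary strings. -/
abbrev BitString : Type := List Bool

/-! ### Prefix machines and Kolmogorov complexity -/

/-- No element of `S` is a proper prefix of another element of `S`. -/
def PrefixFree (S : Set BitString) : Prop :=
  ∀ z ∈ S, ∀ w ∈ S, z <+: w → z = w

/-- A prefix machine: a partial computable function `M z y` of a program `z` and a side input
(condition) `y` such that, for each fixed `y`, the set of halting programs is prefix-free. -/
def IsPrefixMachine (M : BitString → BitString →. BitString) : Prop :=
  Partrec₂ M ∧ ∀ y : BitString, PrefixFree {z | (M z y).Dom}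

/-- A universal prefix machine: it simulates every prefix machine `M` by means of an interpreter
program `σ` that is put in front of the programs of `M`. -/
def IsUniversalPrefixMachine (U : BitString → BitString →. BitString) : Prop :=
  IsPrefixMachine U ∧
    ∀ M : BitString → BitString →. BitString, IsPrefixMachine M →
      ∃ σ : BitString, ∀ z y : BitString, U (σ ++ z) y = M z y

/-- The conditional prefix complexity `K_U(x | y)`: the least length of a program that makes `U`
produce `x` when it is given `y`. -/
noncomputable def condK (U : BitString → BitString →. BitString) (x y : BitString) : ℕ :=
  sInf {n : ℕ | ∃ z : BitString, x ∈ U z y ∧ z.length = n}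

/-- The prefix complexity `K_U(x)`, i.e. the complexity given the empty string. -/
noncomputable def plainK (U : BitString → BitString →. BitString) (x : BitString) : ℕ :=
  condK U x []

/-- The binary string that represents an encodable object. -/
def describe {α : Type*} [Encodable α] (a : α) : BitString :=
  Nat.bits (Encodable.encode a)

/-! ### Machines that compute functions, and the complexity of functions

Machine descriptions are elements of `Nat.Partrec.Code`, Mathlib's Gödel numbering of the partial
computable functions. -/

/-- The machine `c` computes the partial function `f` (same domain, same values). -/
def Computes (c : Nat.Partrec.Code) (f : BitString →. BitString) : Prop :=
  ∀ x : BitString, c.eval (Encodable.encode x) = (f x).map Encodable.encode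

/-- The rational number `m / (d + 1)` that is encoded by the pair `(m, d)`. -/
def ratOf (r : ℤ × ℕ) : ℚ := (r.1 : ℚ) / ((r.2 : ℚ) + 1)

/-- The machine `c` upper-semicomputes the partial function `Q`: for every `x` in the domain of
`Q`, its outputs on `(x, 0), (x, 1), …` are rationals that decrease (weakly) to `Q x`. -/
def UpperSemicomputes (c : Nat.Partrec.Code) (Q : BitString →. ℝ) : Prop :=
  ∀ x : BitString, ∀ q ∈ Q x, ∃ a : ℕ → ℤ × ℕ,
    (∀ n : ℕ, Encodable.encode (a n) ∈ c.eval (Encodable.encode (x, n))) ∧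
    Antitone (fun n => ratOf (a n)) ∧
    Tendsto (fun n => ((ratOf (a n) : ℚ) : ℝ)) atTop (𝓝 q)

/-- `Q` is upper-semicomputable. -/
def UpperSemicomputable (Q : BitString →. ℝ) : Prop :=
  ∃ c : Nat.Partrec.Code, UpperSemicomputes c Q

/-- The machine `c` computes the partial real function `Q`: for every `x` in the domain of `Q`, its
output on `(x, n)` is a rational within `2 ^ (-n)` of `Q x`. -/
def ComputesReal (c : Nat.Partrec.Code) (Q : BitString →. ℝ) : Prop :=
  ∀ x : BitString, ∀ q ∈ Q x, ∀ n : ℕ, ∃ r : ℤ × ℕ,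
    Encodable.encode r ∈ c.eval (Encodable.encode (x, n)) ∧
    |((ratOf r : ℚ) : ℝ) - q| ≤ (2 : ℝ)⁻¹ ^ n

/-- `Q` is a computable (partial) real function. -/
def ComputableReal (Q : BitString →. ℝ) : Prop :=
  ∃ c : Nat.Partrec.Code, ComputesReal c Q

/-- `K_U(f)`: the least length of a self-delimiting program for a machine that computes `f`. -/
noncomputable def funK (U : BitString → BitString →. BitString) (f : BitString →. BitString) : ℕ :=
  sInf {n : ℕ | ∃ c : Nat.Partrec.Code, Computes c f ∧ plainK U (describe c) = n}

/-- `K_U(Q)` for a computable real function `Q`: the least length of a self-delimiting program for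
a machine that approximates `Q` to any desired precision. -/
noncomputable def realK (U : BitString → BitString →. BitString) (Q : BitString →. ℝ) : ℕ :=
  sInf {n : ℕ | ∃ c : Nat.Partrec.Code, ComputesReal c Q ∧ plainK U (describe c) = n}

/-- `K_U(Q)` for an upper-semicomputable real function `Q`. -/
noncomputable def upperK (U : BitString → BitString →. BitString) (Q : BitString →. ℝ) : ℕ :=
  sInf {n : ℕ | ∃ c : Nat.Partrec.Code, UpperSemicomputes c Q ∧ plainK U (describe c) = n}

/-- `K_U(Q, f)`: the least length of a self-delimiting program that jointly describes a machine
that upper-semicomputes `Q` and a machine that computes `f`. -/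
noncomputable def jointK (U : BitString → BitString →. BitString)
    (Q : BitString →. ℝ) (f : BitString →. BitString) : ℕ :=
  sInf {n : ℕ | ∃ c d : Nat.Partrec.Code,
    UpperSemicomputes c Q ∧ Computes d f ∧ plainK U (describe (c, d)) = n}

/-! ### Physical processes, heat, and realizations -/

/-- The data of a process over the countable state space `X ⊆ {0,1}*`: the distribution of the
final state given the initial state, and the heat function, i.e. the expected heat that is
transferred to the bath when the process starts in a given state. -/
structure PhysicalProcess (X : Set BitString) where
  trans : X → PMF X
  heat : X → ℝ

/-- The Shannon entropy (in nats) of a discrete distribution, possibly infinite. -/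
noncomputable def shannonEntropy {α : Type*} (p : PMF α) : ℝ≥0∞ :=
  ∑' a, ENNReal.ofReal (Real.negMulLog (p a).toReal)

namespace PhysicalProcess

variable {X : Set BitString}

/-- The expected entropy production `S(p_Y) - S(p_X) + ⟨Q⟩ / kT` for the initial distribution `p`
(of finite support). -/
noncomputable def entropyProduction (P : PhysicalProcess X) (kT : ℝ) (p : PMF X) : EReal :=
  (shannonEntropy (p.bind P.trans) : EReal) - (shannonEntropy p : EReal)
    + (((∑' x, (p x).toReal * P.heat x) / kT : ℝ) : EReal)

/-- The second law of thermodynamics for a bath at temperature `T`. Initial distributions of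
infinite support are limits of finitely supported ones. -/
def ObeysSecondLaw (P : PhysicalProcess X) (kT : ℝ) : Prop :=
  ∀ p : PMF X, p.support.Finite → 0 ≤ P.entropyProduction kT p

/-- The process realizes `f`: from an initial state `x ∈ dom f` it ends in `f x` with certainty.
Its behaviour on other initial states is arbitrary. -/
def Realizes (P : PhysicalProcess X) (f : BitString →. BitString) : Prop :=
  ∀ x y : BitString, y ∈ f x →
    ∃ (hx : x ∈ X) (hy : y ∈ X), P.trans ⟨x, hx⟩ = PMF.pure ⟨y, hy⟩

/-- The heat function in units of `kT`, as a partial function with domain `dom f` (for a process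
that realizes `f`). -/
noncomputable def heatOn (P : PhysicalProcess X) (kT : ℝ) (f : BitString →. BitString) :
    BitString →. ℝ :=
  fun x => ⟨x ∈ X ∧ (f x).Dom, fun h => P.heat ⟨x, h.1⟩ / kT⟩

end PhysicalProcess

/-- The dominating heat function `kT ln 2 · K_U(x | y)` at an input `x` with output `y`. -/
noncomputable def domHeat (U : BitString → BitString →. BitString) (kT : ℝ) (x y : BitString) : ℝ :=
  kT * Real.log 2 * (condK U x y : ℝ)

/-! ### Prefix-free sets and machines -/

/-! Coding. Fix an output `y`. If the numbers `exp (-Q x)` over the fibre of `y` sum to at most one,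
then `Q x / log 2` is an ideal code length for `x` given `y`. The Kraft–Chaitin construction
realizes it up to a constant, even if `Q` is only approximated from above. Run descriptions of `Q`
and `f` for more and more steps, and issue a request of weight `2 ^ (-(k + 1))` for `x` once both `f
x = y` and `Q x < k * log 2` are certified. At each `x` these weights form part of a geometric
series with sum at most `exp (-Q x)`, so all requests for `y` together weigh at most one
(`sum_reqWeight_stageReq_le`). A single machine reads a self-delimiting description of `Q` and `f`,
then a codeword, and outputs the `x` that was assigned to it (`exists_program_of_requests`). Hence
`condK U x y` exceeds `Q x / log 2` by at most the length of the description plus a constant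
(`condK_le_of_approxFromAbove`). The machine does not depend on `Q` or `f`, so neither does the
constant.

Physics. The second law enters only through the Kraft inequality. If finitely many states all go to
`y`, test the law on their Gibbs distribution, proportional to `exp (-Q / kT)` with normalization
`Z`. The final entropy is zero and the entropy production equals `-log Z`, so `Z ≤ 1`
(`PhysicalProcess.ObeysSecondLaw.sum_exp_le_one`). This reduces the tradeoff for realizations to the
coding bound. Conversely, a deterministic process with the Kraft inequality on every fibre obeys the
law, by Gibbs' inequality inside each fibre (`PhysicalProcess.obeysSecondLaw_of_deterministic`).
Shortest programs for a fixed side input form a prefix-free set, so `condK U · y` satisfies Kraft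
(`sum_condK_le_one`), which makes the dominating heat function admissible. -/

theorem PrefixFree.mono {S T : Set BitString} (hT : PrefixFree T) (h : S ⊆ T) : PrefixFree S :=
  fun z hz w hw => hT z (h hz) w (h hw)

/-- Two prefixes of one string are comparable, so a self-delimiting first part is determined by the
whole string. -/
theorem PrefixFree.append_inj {S : Set BitString} (hS : PrefixFree S) {p q v w : BitString}
    (hp : p ∈ S) (hq : q ∈ S) (h : p ++ v <+: q ++ w) : p = q ∧ v <+: w := by
  have h1 : p <+: q ++ w := (List.prefix_append p v).trans h
  have hpq : p = q := by
    rcases List.prefix_or_prefix_of_prefix h1 (List.prefix_append q w) with h2 | h2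
    · exact hS p hp q hq h2
    · exact (hS q hq p hp h2).symm
  subst hpq
  exact ⟨rfl, (List.prefix_append_right_inj p).1 h⟩

theorem Partrec.exists_code {α β : Type*} [Primcodable α] [Primcodable β] {f : α →. β}
    (hf : Partrec f) :
    ∃ c : Nat.Partrec.Code, ∀ a, c.eval (Encodable.encode a) = (f a).map Encodable.encode := by
  obtain ⟨c, hc⟩ := Nat.Partrec.Code.exists_code.1 hf
  exact ⟨c, fun a => by simp [hc]⟩

/-- Running the machine `N` after the self-delimiting decoder `D`: the machine reads a program `p`
of `D` and hands the decoded value and the rest of the input to `N`. -/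
theorem exists_prefixFree_append {α β : Type*} [Primcodable α] [Primcodable β]
    {D : BitString →. α} (hD : Partrec D) (hDp : PrefixFree {p | (D p).Dom})
    {N : (α × BitString) × BitString →. β} (hN : Partrec N)
    (hNp : ∀ a y, PrefixFree {w | (N ((a, y), w)).Dom}) :
    ∃ M : BitString → BitString →. β, Partrec₂ M ∧ (∀ y, PrefixFree {z | (M z y).Dom}) ∧
      ∀ p w y a b, a ∈ D p → b ∈ N ((a, y), w) → b ∈ M (p ++ w) y := by
  have hG : Partrec fun t : BitString × BitString × BitString =>
      (D t.1).bind fun a => N ((a, t.2.2), t.2.1) :=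
    Partrec.bind (hD.comp Computable.fst) (hN.comp (Computable.pair (Computable.pair Computable.snd
      (Computable.snd.comp (Computable.snd.comp Computable.fst)))
      (Computable.fst.comp (Computable.snd.comp Computable.fst)))).to₂
  obtain ⟨c, hc⟩ := hG.exists_code
  -- Where the input splits is not known in advance, so `n` codes a pair of a split position and a
  -- step bound, and all pairs are searched in turn.
  let F : BitString × BitString → ℕ → Option β := fun t n =>
    (Nat.Partrec.Code.evaln n.unpair.2 c
      (Encodable.encode (t.1.take n.unpair.1, t.1.drop n.unpair.1, t.2))).bind Encodable.decode
  have hF : Primrec₂ F := by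
    refine Primrec.option_bind (f := fun t : (BitString × BitString) × ℕ =>
      Nat.Partrec.Code.evaln t.2.unpair.2 c (Encodable.encode
        (t.1.1.take t.2.unpair.1, t.1.1.drop t.2.unpair.1, t.1.2))) ?_
      (Primrec.decode.comp Primrec.snd).to₂
    have h1 : Primrec fun t : (BitString × BitString) × ℕ => t.2.unpair.1 :=
      Primrec.fst.comp (Primrec.unpair.comp Primrec.snd)
    have h2 : Primrec fun t : (BitString × BitString) × ℕ => t.2.unpair.2 :=
      Primrec.snd.comp (Primrec.unpair.comp Primrec.snd)
    have h3 : Primrec fun t : (BitString × BitString) × ℕ => t.1.1 :=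
      Primrec.fst.comp Primrec.fst
    exact Nat.Partrec.Code.primrec_evaln.comp (Primrec.pair (Primrec.pair h2 (Primrec.const c))
      (Primrec.encode.comp (Primrec.pair (Primrec.list_take.comp h1 h3)
        (Primrec.pair (Primrec.list_drop.comp h1 h3) (Primrec.snd.comp Primrec.fst)))))
  have hFspec : ∀ z y n b, b ∈ F (z, y) n → ∃ p w a, z = p ++ w ∧ a ∈ D p ∧ b ∈ N ((a, y), w) := by
    intro z y n b hb
    obtain ⟨m, hm, hb⟩ := Option.mem_bind_iff.1 hb
    have hm := Nat.Partrec.Code.evaln_sound hm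
    rw [hc] at hm
    obtain ⟨b', hb', rfl⟩ := (Part.mem_map_iff _).1 hm
    obtain ⟨a, ha, hb'⟩ := Part.mem_bind_iff.1 hb'
    rw [Encodable.encodek, Option.mem_some_iff] at hb
    subst hb
    exact ⟨_, _, a, (List.take_append_drop _ z).symm, ha, hb'⟩
  have hFex : ∀ p w y a b, a ∈ D p → b ∈ N ((a, y), w) → ∃ n, b ∈ F (p ++ w, y) n := by
    intro p w y a b ha hb
    have : Encodable.encode b ∈ c.eval (Encodable.encode (p, w, y)) := by
      rw [hc]
      exact (Part.mem_map_iff _).2 ⟨b, Part.mem_bind_iff.2 ⟨a, ha, hb⟩, rfl⟩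
    obtain ⟨k, hk⟩ := Nat.Partrec.Code.evaln_complete.1 this
    refine ⟨Nat.pair p.length k, Option.mem_bind_iff.2 ⟨Encodable.encode b, ?_, by simp⟩⟩
    simpa using hk
  refine ⟨fun z y => Nat.rfindOpt (F (z, y)), Partrec.rfindOpt hF.to_comp, ?_, ?_⟩
  · intro y z hz z' hz' hzz
    obtain ⟨n, b, hb⟩ := Nat.rfindOpt_dom.1 hz
    obtain ⟨n', b', hb'⟩ := Nat.rfindOpt_dom.1 hz'
    obtain ⟨p, w, a, rfl, ha, hN1⟩ := hFspec _ _ _ _ hb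
    obtain ⟨p', w', a', rfl, ha', hN2⟩ := hFspec _ _ _ _ hb'
    obtain ⟨rfl, hww⟩ := hDp.append_inj (Part.dom_iff_mem.2 ⟨a, ha⟩)
      (Part.dom_iff_mem.2 ⟨a', ha'⟩) hzz
    obtain rfl := Part.mem_unique ha ha'
    rw [hNp a y w (Part.dom_iff_mem.2 ⟨b, hN1⟩) w' (Part.dom_iff_mem.2 ⟨b', hN2⟩) hww]
  · intro p w y a b ha hb
    obtain ⟨n, hn⟩ := hFex p w y a b ha hb
    -- The search may stop at another index than `n`, but the split into a `D`-program and a rest is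
    -- unique, so the output is the same.
    obtain ⟨b', hb'⟩ := Part.dom_iff_mem.1 (Nat.rfindOpt_dom.2 ⟨n, b, hn⟩)
    obtain ⟨n', hn'⟩ := Nat.rfindOpt_spec hb'
    obtain ⟨p', w', a', hz, ha', hN2⟩ := hFspec _ _ _ _ hn'
    obtain ⟨rfl, hww⟩ := hDp.append_inj (Part.dom_iff_mem.2 ⟨a, ha⟩)
      (Part.dom_iff_mem.2 ⟨a', ha'⟩) ⟨[], by simpa using hz⟩
    obtain rfl := Part.mem_unique ha ha'
    obtain rfl := List.append_cancel_left hz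
    rwa [Part.mem_unique hb hN2]

/-! ### Codewords from dyadic intervals -/

/-- The natural number with the given binary expansion, most significant digit first. -/
def bitVal (w : BitString) : ℕ :=
  w.foldl (fun n b => 2 * n + b.toNat) 0

theorem bitVal_concat (w : BitString) (b : Bool) : bitVal (w ++ [b]) = 2 * bitVal w + b.toNat := by
  simp [bitVal]

theorem primrec_bitVal : Primrec bitVal :=
  Primrec.list_foldl Primrec.id (Primrec.const 0)
    (Primrec.nat_add.comp (Primrec.nat_double.comp (Primrec.fst.comp Primrec.snd))
      ((Primrec.dom_finite Bool.toNat).comp (Primrec.snd.comp Primrec.snd))).to₂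

theorem bitVal_append (v w : BitString) :
    bitVal v * 2 ^ w.length ≤ bitVal (v ++ w) ∧
      bitVal (v ++ w) + 1 ≤ (bitVal v + 1) * 2 ^ w.length := by
  induction w using List.reverseRecOn with
  | nil => simp
  | append_singleton w b ih =>
    rw [← List.append_assoc, bitVal_concat, List.length_append, List.length_singleton, pow_succ]
    have := b.toNat_le
    constructor <;> nlinarith [ih.1, ih.2]

theorem exists_bitVal_eq (l n : ℕ) (hn : n < 2 ^ l) :
    ∃ w : BitString, w.length = l ∧ bitVal w = n := by
  induction l generalizing n with
  | zero => exact ⟨[], rfl, by simp [bitVal]; omega⟩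
  | succ l ih =>
    obtain ⟨w, hw, hv⟩ := ih (n / 2) (by rw [pow_succ] at hn; omega)
    refine ⟨w ++ [n.bodd], by simp [hw], ?_⟩
    rw [bitVal_concat, hv]
    have := Nat.bodd_add_div2 n
    rw [Nat.div2_val] at this
    omega

/-- The left end of the dyadic interval of a string. -/
noncomputable def lowEnd (w : BitString) : ℝ := bitVal w / 2 ^ w.length

/-- Each further bit selects one half of the current dyadic interval. The prefix order thus becomes
containment of intervals, and disjoint intervals belong to incomparable strings. -/
theorem lowEnd_append (v w : BitString) : lowEnd v ≤ lowEnd (v ++ w) ∧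
    lowEnd (v ++ w) + 2⁻¹ ^ (v ++ w).length ≤ lowEnd v + 2⁻¹ ^ v.length := by
  obtain ⟨h1, h2⟩ := bitVal_append v w
  have h1' : (bitVal v : ℝ) * 2 ^ w.length ≤ bitVal (v ++ w) := by exact_mod_cast h1
  have h2' : (bitVal (v ++ w) : ℝ) + 1 ≤ (bitVal v + 1) * 2 ^ w.length := by exact_mod_cast h2
  simp only [lowEnd, inv_pow, List.length_append, pow_add]
  constructor
  · rw [div_le_div_iff₀ (by positivity) (by positivity)]
    nlinarith [show (0 : ℝ) < 2 ^ v.length by positivity]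
  · rw [← mul_inv, ← one_div, ← one_div, ← add_div, ← add_div,
      div_le_div_iff₀ (by positivity) (by positivity)]
    nlinarith [show (0 : ℝ) < 2 ^ v.length by positivity]

/-! ### Coding requests -/

/-- The weight of a request: `2 ^ (-k)` for the request of a codeword of length about `k`. -/
noncomputable def reqWeight (r : Option (BitString × ℕ)) : ℝ :=
  r.elim 0 fun t => 2⁻¹ ^ t.2

theorem reqWeight_nonneg (r : Option (BitString × ℕ)) : 0 ≤ reqWeight r := by
  cases r <;> simp [reqWeight]

/-- Adding the weight of a request to the number `s.1 / 2 ^ s.2`. -/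
def addReq (s : ℕ × ℕ) (r : Option (BitString × ℕ)) : ℕ × ℕ :=
  r.elim s fun t => (s.1 * 2 ^ t.2 + 2 ^ s.2, s.2 + t.2)

/-- The total weight `s.1 / 2 ^ s.2` of the first `n` requests. -/
def reqTotal (R : ℕ → Option (BitString × ℕ)) (n : ℕ) : ℕ × ℕ :=
  n.rec (0, 0) fun i s => addReq s (R i)

theorem addReq_val (s : ℕ × ℕ) (r : Option (BitString × ℕ)) :
    ((addReq s r).1 : ℝ) / 2 ^ (addReq s r).2 = s.1 / 2 ^ s.2 + reqWeight r := by
  cases r with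
  | none => simp [addReq, reqWeight]
  | some t =>
    simp only [addReq, reqWeight, Option.elim_some, pow_add, inv_pow]
    push_cast
    field_simp

theorem reqTotal_val (R : ℕ → Option (BitString × ℕ)) (n : ℕ) :
    ((reqTotal R n).1 : ℝ) / 2 ^ (reqTotal R n).2 = ∑ i ∈ Finset.range n, reqWeight (R i) := by
  induction n with
  | zero => simp [reqTotal]
  | succ n ih =>
    rw [Finset.sum_range_succ, ← ih, ← addReq_val]
    rfl

/-- The string `w` is one bit longer than requested, and its dyadic interval lies in the interval
of the request `t` that starts at `s.1 / 2 ^ s.2`. -/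
def FitsReq (s : ℕ × ℕ) (t : BitString × ℕ) (w : BitString) : Prop :=
  w.length = t.2 + 1 ∧ s.1 * 2 ^ w.length ≤ bitVal w * 2 ^ s.2 ∧
    (bitVal w + 1) * 2 ^ (s.2 + t.2) ≤ (s.1 * 2 ^ t.2 + 2 ^ s.2) * 2 ^ w.length

instance (s : ℕ × ℕ) (t : BitString × ℕ) (w : BitString) : Decidable (FitsReq s t w) :=
  inferInstanceAs (Decidable (_ ∧ _ ∧ _))

/-- The integer inequalities of the definition can be tested by a machine; this real form carries
the geometry. -/
theorem fitsReq_iff (s : ℕ × ℕ) (t : BitString × ℕ) (w : BitString) :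
    FitsReq s t w ↔ w.length = t.2 + 1 ∧ (s.1 : ℝ) / 2 ^ s.2 ≤ lowEnd w ∧
      lowEnd w + 2⁻¹ ^ w.length ≤ s.1 / 2 ^ s.2 + 2⁻¹ ^ t.2 := by
  have e := addReq_val s (some t)
  simp only [addReq, reqWeight, Option.elim_some] at e
  rw [FitsReq, ← e, lowEnd, inv_pow, ← one_div, ← add_div,
    div_le_div_iff₀ (by positivity) (by positivity),
    div_le_div_iff₀ (by positivity) (by positivity)]
  norm_cast

/-- An interval of length `2 ^ (-k)` has twice the mesh of the grid of step `2 ^ (-(k + 1))`, so it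
contains a whole grid cell wherever it starts. This is what the extra bit of the codeword buys;
rounding the left end up finds the cell. -/
theorem exists_fitsReq (s : ℕ × ℕ) (t : BitString × ℕ)
    (h : (s.1 : ℝ) / 2 ^ s.2 + 2⁻¹ ^ t.2 ≤ 1) : ∃ w, FitsReq s t w := by
  set S : ℝ := (s.1 : ℝ) / 2 ^ s.2
  have hS : 0 ≤ S := by positivity
  have hpow : (0 : ℝ) < 2 ^ (t.2 + 1) := by positivity
  have e : (2⁻¹ : ℝ) ^ t.2 = 2 / 2 ^ (t.2 + 1) := by
    rw [inv_pow, pow_succ]; field_simp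
  have h1 := Nat.ceil_lt_add_one (a := S * 2 ^ (t.2 + 1)) (by positivity)
  have h2 := Nat.le_ceil (S * 2 ^ (t.2 + 1))
  have h3 : S * 2 ^ (t.2 + 1) + 2 ≤ 2 ^ (t.2 + 1) := by
    rw [e] at h
    calc S * 2 ^ (t.2 + 1) + 2 = (S + 2 / 2 ^ (t.2 + 1)) * 2 ^ (t.2 + 1) := by field_simp
      _ ≤ 1 * 2 ^ (t.2 + 1) := by gcongr
      _ = _ := one_mul _
  obtain ⟨w, hw, hv⟩ := exists_bitVal_eq (t.2 + 1) ⌈S * 2 ^ (t.2 + 1)⌉₊ (by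
    have : ((⌈S * 2 ^ (t.2 + 1)⌉₊ : ℕ) : ℝ) < ((2 ^ (t.2 + 1) : ℕ) : ℝ) := by
      push_cast; linarith
    exact_mod_cast this)
  refine ⟨w, (fitsReq_iff _ _ _).2 ⟨hw, ?_, ?_⟩⟩
  · rw [lowEnd, hw, hv, le_div_iff₀ hpow]
    exact h2
  · rw [lowEnd, hw, hv, e, inv_pow, ← one_div, ← add_div, div_le_iff₀ hpow, add_mul,
      div_mul_cancel₀ _ hpow.ne']
    linarith

/-- Successive requests occupy adjacent intervals without overlap, while a prefix relation would
nest the codeword intervals. For one and the same request the equal lengths decide. -/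
theorem FitsReq.eq_of_prefix {R : ℕ → Option (BitString × ℕ)} {i j : ℕ} {t u : BitString × ℕ}
    {v w : BitString} (ht : R i = some t) (hu : R j = some u) (hv : FitsReq (reqTotal R i) t v)
    (hw : FitsReq (reqTotal R j) u w) (h : v <+: w) : i = j ∧ v = w := by
  obtain ⟨x, rfl⟩ := h
  rw [fitsReq_iff, reqTotal_val] at hv hw
  obtain ⟨h1, h2⟩ := lowEnd_append v x
  have hpos : (0 : ℝ) < 2⁻¹ ^ (v ++ x).length := by positivity
  have key : ∀ {i j : ℕ} {t : BitString × ℕ}, R i = some t → i < j →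
      ∑ k ∈ Finset.range i, reqWeight (R k) + 2⁻¹ ^ t.2 ≤
        ∑ k ∈ Finset.range j, reqWeight (R k) := by
    intro i j t ht hij
    calc _ = ∑ k ∈ Finset.range (i + 1), reqWeight (R k) := by
          rw [Finset.sum_range_succ, ht]; rfl
      _ ≤ _ := Finset.sum_le_sum_of_subset_of_nonneg
          (Finset.range_mono hij) fun _ _ _ => reqWeight_nonneg _
  rcases lt_trichotomy i j with hij | rfl | hij
  · have := key ht hij
    linarith [hv.2.1, hv.2.2, hw.2.1, hw.2.2]
  · rw [ht, Option.some_inj] at hu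
    subst hu
    refine ⟨rfl, (List.prefix_append v x).eq_of_length (hv.1.trans hw.1.symm)⟩
  · have := key hu hij
    linarith [hv.2.1, hv.2.2, hw.2.1, hw.2.2]

theorem primrec_nat_pow : Primrec₂ ((· ^ ·) : ℕ → ℕ → ℕ) :=
  (Primrec.nat_rec' (f := fun t : ℕ × ℕ => t.2) (g := fun _ => 1) (h := fun t u => u.2 * t.1)
    Primrec.snd (Primrec.const 1) (Primrec.nat_mul.comp (Primrec.snd.comp Primrec.snd)
      (Primrec.fst.comp Primrec.fst)).to₂).of_eq fun t => by
    induction t.2 with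
    | zero => simp
    | succ n ih => simp only [pow_succ, ← ih]

theorem primrec_two_pow {α : Type*} [Primcodable α] {f : α → ℕ} (hf : Primrec f) :
    Primrec fun a => 2 ^ f a :=
  primrec_nat_pow.comp (Primrec.const 2) hf

theorem primrec_addReq : Primrec₂ addReq := by
  refine (Primrec.option_casesOn (o := fun t : (ℕ × ℕ) × Option (BitString × ℕ) => t.2)
    (f := fun t => t.1) (g := fun t u => (t.1.1 * 2 ^ u.2 + 2 ^ t.1.2, t.1.2 + u.2))
    Primrec.snd Primrec.fst ?_).of_eq fun t => by rcases t with ⟨s, _ | u⟩ <;> rfl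
  have h1 : Primrec fun t : ((ℕ × ℕ) × Option (BitString × ℕ)) × (BitString × ℕ) => t.1.1 :=
    Primrec.fst.comp Primrec.fst
  have h2 : Primrec fun t : ((ℕ × ℕ) × Option (BitString × ℕ)) × (BitString × ℕ) => t.2.2 :=
    Primrec.snd.comp Primrec.snd
  exact Primrec.pair (Primrec.nat_add.comp (Primrec.nat_mul.comp (Primrec.fst.comp h1)
    (primrec_two_pow h2)) (primrec_two_pow (Primrec.snd.comp h1)))
    (Primrec.nat_add.comp (Primrec.snd.comp h1) h2)

theorem primrec_reqTotal {α : Type*} [Primcodable α] {R : α → ℕ → Option (BitString × ℕ)}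
    (hR : Primrec₂ R) : Primrec₂ fun a n => reqTotal (R a) n := by
  refine Primrec.nat_rec' (f := fun t : α × ℕ => t.2) (g := fun _ => (0, 0))
    (h := fun t u => addReq u.2 (R t.1 u.1)) Primrec.snd (Primrec.const _) ?_
  exact primrec_addReq.comp (Primrec.snd.comp Primrec.snd)
    (hR.comp (Primrec.fst.comp Primrec.fst) (Primrec.fst.comp Primrec.snd))

theorem primrecPred_fitsReq :
    PrimrecPred fun t : ((ℕ × ℕ) × (BitString × ℕ)) × BitString => FitsReq t.1.1 t.1.2 t.2 := by
  have hs : Primrec fun t : ((ℕ × ℕ) × (BitString × ℕ)) × BitString => t.1.1 :=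
    Primrec.fst.comp Primrec.fst
  have hk : Primrec fun t : ((ℕ × ℕ) × (BitString × ℕ)) × BitString => t.1.2.2 :=
    Primrec.snd.comp (Primrec.snd.comp Primrec.fst)
  have hl : Primrec fun t : ((ℕ × ℕ) × (BitString × ℕ)) × BitString => t.2.length :=
    Primrec.list_length.comp Primrec.snd
  have hv : Primrec fun t : ((ℕ × ℕ) × (BitString × ℕ)) × BitString => bitVal t.2 :=
    primrec_bitVal.comp Primrec.snd
  have hs1 := Primrec.fst.comp hs
  have hs2 := Primrec.snd.comp hs
  refine (Primrec.eq.comp hl (Primrec.succ.comp hk)).and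
    ((Primrec.nat_le.comp (Primrec.nat_mul.comp hs1 (primrec_two_pow hl))
      (Primrec.nat_mul.comp hv (primrec_two_pow hs2))).and
    (Primrec.nat_le.comp (Primrec.nat_mul.comp (Primrec.succ.comp hv)
      (primrec_two_pow (Primrec.nat_add.comp hs2 hk)))
      (Primrec.nat_mul.comp (Primrec.nat_add.comp (Primrec.nat_mul.comp hs1 (primrec_two_pow hk))
        (primrec_two_pow hs2)) (primrec_two_pow hl))))

/-- The Kraft–Chaitin theorem, for requests that depend on a self-delimiting program `p` and on a
side input `y`: if the requests have total weight at most one, each of them can be met. -/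
theorem exists_program_of_requests {U : BitString → BitString →. BitString}
    (hU : IsUniversalPrefixMachine U) {α : Type*} [Primcodable α] {D : BitString →. α}
    (hD : Partrec D) (hDp : PrefixFree {p | (D p).Dom})
    {R : α × BitString → ℕ → Option (BitString × ℕ)} (hR : Primrec₂ R) :
    ∃ C : ℕ, ∀ p a y, a ∈ D p → (∀ n, ∑ i ∈ Finset.range n, reqWeight (R (a, y) i) ≤ 1) →
      ∀ i x k, R (a, y) i = some (x, k) →
        ∃ z, x ∈ U z y ∧ z.length ≤ p.length + k + C := by
  let F : (α × BitString) × BitString → ℕ → Option BitString := fun t i =>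
    (R t.1 i).bind fun r => if FitsReq (reqTotal (R t.1) i) r t.2 then some r.1 else none
  have hFspec : ∀ {t i x}, F t i = some x →
      ∃ k, R t.1 i = some (x, k) ∧ FitsReq (reqTotal (R t.1) i) (x, k) t.2 := by
    intro t i x h
    obtain ⟨⟨x', k⟩, hr, h⟩ := Option.bind_eq_some_iff.1 h
    by_cases hf : FitsReq (reqTotal (R t.1) i) (x', k) t.2
    · rw [if_pos hf, Option.some_inj] at h
      obtain rfl : x' = x := h
      exact ⟨k, hr, hf⟩
    · simp [hf] at h
  have hF : Primrec₂ F := by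
    refine Primrec.option_bind (f := fun t : ((α × BitString) × BitString) × ℕ => R t.1.1 t.2)
      (hR.comp (Primrec.fst.comp Primrec.fst) Primrec.snd) ?_
    refine Primrec.ite ?_ (Primrec.option_some.comp (Primrec.fst.comp Primrec.snd))
      (Primrec.const none)
    exact primrecPred_fitsReq.comp (Primrec.pair (Primrec.pair
      ((primrec_reqTotal hR).comp (Primrec.fst.comp (Primrec.fst.comp Primrec.fst))
        (Primrec.snd.comp Primrec.fst)) Primrec.snd)
      (Primrec.snd.comp (Primrec.fst.comp Primrec.fst)))
  -- Prefix-freeness holds whether or not the total weight is bounded, so `M` is a prefix machine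
  -- even on descriptions that violate Kraft. The weight bound is needed only for codewords to
  -- exist.
  obtain ⟨M, hM, hMp, hMr⟩ := exists_prefixFree_append hD hDp
    (N := fun t => Nat.rfindOpt (F t)) (Partrec.rfindOpt hF.to_comp) (by
      intro a y v hv w hw hvw
      obtain ⟨i, x, hi⟩ := Nat.rfindOpt_dom.1 hv
      obtain ⟨j, x', hj⟩ := Nat.rfindOpt_dom.1 hw
      obtain ⟨k, hk, hf⟩ := hFspec hi
      obtain ⟨k', hk', hf'⟩ := hFspec hj
      exact (FitsReq.eq_of_prefix hk hk' hf hf' hvw).2)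
  obtain ⟨σ, hσ⟩ := hU.2 M ⟨hM, hMp⟩
  -- The constant consists of the interpreter `σ` and the extra bit of the codeword.
  refine ⟨σ.length + 1, fun p a y ha hsum i x k hi => ?_⟩
  obtain ⟨w, hw⟩ := exists_fitsReq (reqTotal (R (a, y)) i) (x, k) (by
    have := hsum (i + 1)
    rw [Finset.sum_range_succ, ← reqTotal_val, hi] at this
    exact this)
  have hFi : F ((a, y), w) i = some x := by simp [F, hi, hw]
  have hx : x ∈ Nat.rfindOpt (F ((a, y), w)) := by
    obtain ⟨x', hx'⟩ := Part.dom_iff_mem.1 (Nat.rfindOpt_dom.2 ⟨i, x, hFi⟩)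
    obtain ⟨j, hj⟩ := Nat.rfindOpt_spec hx'
    obtain ⟨k', hk', hf'⟩ := hFspec hj
    obtain ⟨rfl, -⟩ := FitsReq.eq_of_prefix hi hk' hw hf' List.prefix_rfl
    rw [hi] at hk'
    obtain ⟨rfl, -⟩ := Prod.mk.inj (Option.some.inj hk')
    exact hx'
  refine ⟨σ ++ (p ++ w), ?_, ?_⟩
  · rw [hσ]
    exact hMr p w y a x ha hx
  · have := hw.1
    simp only [List.length_append, this]
    omega

/-! ### Existence of shortest programs. -/

theorem condK_le_length {U : BitString → BitString →. BitString} {x y z : BitString}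
    (h : x ∈ U z y) : condK U x y ≤ z.length :=
  Nat.sInf_le ⟨z, h, rfl⟩

theorem prefixFree_singleton (p : BitString) : PrefixFree {p} := by
  rintro z rfl w rfl _
  rfl

/-- The infimum that defines `condK` would be the junk value `0` on an empty set, so every `x` needs
some program. Requesting the string with code `i` at weight `2 ^ (-(i + 1))` provides one; the
decoder accepts only the empty program. -/
theorem exists_program {U : BitString → BitString →. BitString}
    (hU : IsUniversalPrefixMachine U) (x y : BitString) : ∃ z, x ∈ U z y := by
  let D : BitString →. Unit := fun p => ((if p = [] then some () else none : Option Unit) : Part _)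
  have hD : Partrec D := Computable.ofOption (Primrec.ite
    (Primrec.eq.comp Primrec.id (Primrec.const [])) (Primrec.const _) (Primrec.const _)).to_comp
  have hDp : PrefixFree {p | (D p).Dom} := (prefixFree_singleton []).mono fun p hp => by
    by_contra h
    simp [D, show p ≠ [] from h] at hp
  let R : Unit × BitString → ℕ → Option (BitString × ℕ) := fun _ i =>
    (Encodable.decode i).map fun x => (x, i + 1)
  have hR : Primrec₂ R := Primrec.option_map (Primrec.decode.comp Primrec.snd)
    (Primrec.pair Primrec.snd (Primrec.succ.comp (Primrec.snd.comp Primrec.fst))).to₂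
  obtain ⟨C, hC⟩ := exists_program_of_requests hU hD hDp hR
  have hle : ∀ n, ∑ i ∈ Finset.range n, reqWeight (R ((), y) i) ≤ 1 - 2⁻¹ ^ n := by
    intro n
    induction n with
    | zero => simp
    | succ n ih =>
      have : reqWeight (R ((), y) n) ≤ 2⁻¹ ^ (n + 1) := by
        simp only [R]
        cases (Encodable.decode n : Option BitString) <;> simp [reqWeight]
      rw [Finset.sum_range_succ]
      have e : (2⁻¹ : ℝ) ^ n = 2⁻¹ ^ (n + 1) + 2⁻¹ ^ (n + 1) := by rw [pow_succ]; ring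
      linarith
  obtain ⟨z, hz, -⟩ := hC [] () y (by simp [D])
    (fun n => (hle n).trans (by simp))
    (Encodable.encode x) x (Encodable.encode x + 1) (by simp [R])
  exact ⟨z, hz⟩

theorem exists_program_length_eq_condK {U : BitString → BitString →. BitString}
    (hU : IsUniversalPrefixMachine U) (x y : BitString) :
    ∃ z, x ∈ U z y ∧ z.length = condK U x y := by
  obtain ⟨z, hz⟩ := exists_program hU x y
  exact Nat.sInf_mem (s := {n : ℕ | ∃ z : BitString, x ∈ U z y ∧ z.length = n}) ⟨_, z, hz, rfl⟩

/-! ### Certificates for `exp (a / (d + 1)) < 2 ^ k` -/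

/-- The nonnegative rational number `a / (d + 1)`. -/
noncomputable def nnratOf (r : ℕ × ℕ) : ℝ := r.1 / (r.2 + 1)

/-- A certificate for `exp (nnratOf r) < 2 ^ k`, with precision `s`, from the bound
`exp 1 ≤ (1 + 1 / (s + 1)) ^ (s + 2)`. -/
def ExpCert (r : ℕ × ℕ) (k s : ℕ) : Prop :=
  (s + 2) ^ ((s + 2) * r.1) < 2 ^ (k * (r.2 + 1)) * (s + 1) ^ ((s + 2) * r.1)

instance (r : ℕ × ℕ) (k s : ℕ) : Decidable (ExpCert r k s) :=
  inferInstanceAs (Decidable (_ < _))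

theorem expCert_iff (r : ℕ × ℕ) (k s : ℕ) :
    ExpCert r k s ↔ ((1 + 1 / ((s : ℝ) + 1)) ^ (s + 2)) ^ r.1 < 2 ^ (k * (r.2 + 1)) := by
  have h : 1 + 1 / ((s : ℝ) + 1) = (s + 2) / (s + 1) := by field_simp; ring
  rw [h, ← pow_mul, div_pow, div_lt_iff₀ (by positivity), ExpCert]
  norm_cast

/-- This is `1 - u ≤ exp (-u)` at `u = 1 / (s + 2)`, inverted and raised to the power `s + 2`. -/
theorem exp_one_le (s : ℕ) : Real.exp 1 ≤ (1 + 1 / ((s : ℝ) + 1)) ^ (s + 2) := by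
  have h : Real.exp (1 / ((s : ℝ) + 2)) ≤ 1 + 1 / ((s : ℝ) + 1) := by
    have h1 := Real.add_one_le_exp (-(1 / ((s : ℝ) + 2)))
    rw [Real.exp_neg] at h1
    have h2 : -(1 / ((s : ℝ) + 2)) + 1 = (1 + 1 / ((s : ℝ) + 1))⁻¹ := by
      field_simp; ring
    rw [h2] at h1
    exact (inv_le_inv₀ (by positivity) (Real.exp_pos _)).1 h1
  calc Real.exp 1 = Real.exp (1 / ((s : ℝ) + 2)) ^ (s + 2) := by
        rw [← Real.exp_nat_mul]
        congr 1
        push_cast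
        field_simp
    _ ≤ _ := by gcongr

theorem tendsto_exp_one_bound :
    Tendsto (fun s : ℕ => (1 + 1 / ((s : ℝ) + 1)) ^ (s + 2)) atTop (𝓝 (Real.exp 1)) := by
  have h1 := (tendsto_add_atTop_iff_nat 1).2 (Real.tendsto_one_add_div_pow_exp 1)
  have h2 : Tendsto (fun s : ℕ => 1 + 1 / ((s : ℝ) + 1)) atTop (𝓝 (1 + 0)) :=
    tendsto_const_nhds.add tendsto_one_div_add_atTop_nhds_zero_nat
  have h3 := h1.mul h2
  rw [add_zero, mul_one] at h3
  refine h3.congr fun s => ?_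
  rw [pow_succ _ (s + 1)]
  push_cast
  rfl

theorem exp_one_pow_lt_iff (r : ℕ × ℕ) (k : ℕ) :
    Real.exp 1 ^ r.1 < 2 ^ (k * (r.2 + 1)) ↔ nnratOf r < k * Real.log 2 := by
  have h : (2 : ℝ) ^ (k * (r.2 + 1)) = Real.exp ((k * ((r.2 : ℝ) + 1)) * Real.log 2) := by
    rw [mul_comm _ (Real.log 2), Real.exp_mul, Real.exp_log two_pos]
    exact_mod_cast (Real.rpow_natCast 2 (k * (r.2 + 1))).symm
  rw [h, ← Real.exp_nat_mul, Real.exp_lt_exp, nnratOf, div_lt_iff₀ (by positivity)]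
  constructor <;> intro h <;> linarith

theorem ExpCert.lt {r : ℕ × ℕ} {k s : ℕ} (h : ExpCert r k s) : nnratOf r < k * Real.log 2 := by
  rw [expCert_iff] at h
  exact (exp_one_pow_lt_iff r k).1
    ((pow_le_pow_left₀ (Real.exp_pos 1).le (exp_one_le s) r.1).trans_lt h)

/-- Completeness of the certificates: the bounds for `exp 1` converge to it, so every true strict
inequality is certified from some precision on. -/
theorem eventually_expCert {r : ℕ × ℕ} {k : ℕ} (h : nnratOf r < k * Real.log 2) :
    ∀ᶠ s in atTop, ExpCert r k s := by
  have h1 := (tendsto_exp_one_bound.pow r.1).eventually_lt_const ((exp_one_pow_lt_iff r k).2 h)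
  filter_upwards [h1] with s hs
  exact (expCert_iff r k s).2 hs

theorem primrecPred_expCert :
    PrimrecPred fun t : (ℕ × ℕ) × ℕ × ℕ => ExpCert t.1 t.2.1 t.2.2 := by
  have hr1 : Primrec fun t : (ℕ × ℕ) × ℕ × ℕ => t.1.1 := Primrec.fst.comp Primrec.fst
  have hr2 : Primrec fun t : (ℕ × ℕ) × ℕ × ℕ => t.1.2 := Primrec.snd.comp Primrec.fst
  have hk : Primrec fun t : (ℕ × ℕ) × ℕ × ℕ => t.2.1 := Primrec.fst.comp Primrec.snd
  have hs1 : Primrec fun t : (ℕ × ℕ) × ℕ × ℕ => t.2.2 + 1 :=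
    Primrec.succ.comp (Primrec.snd.comp Primrec.snd)
  have hs2 : Primrec fun t : (ℕ × ℕ) × ℕ × ℕ => t.2.2 + 2 := Primrec.succ.comp hs1
  have he := Primrec.nat_mul.comp hs2 hr1
  exact Primrec.nat_lt.comp (primrec_nat_pow.comp hs2 he)
    (Primrec.nat_mul.comp (primrec_two_pow (Primrec.nat_mul.comp hk (Primrec.succ.comp hr2)))
      (primrec_nat_pow.comp hs1 he))

/-! ### Coding requests from machines -/

open Nat.Partrec (Code)

/-- The outputs of `c` on `(x, 0), (x, 1), …`, transformed by `g`, are upper bounds of `q` that come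
arbitrarily close to `q`. -/
def ApproxFromAbove (c : Code) (g : ℕ × ℕ → ℕ × ℕ) (x : BitString) (q : ℝ) : Prop :=
  ∃ v : ℕ → ℕ, (∀ j, v j ∈ c.eval (Encodable.encode (x, j))) ∧ (∀ j, q ≤ nnratOf (g (v j, j))) ∧
    ∀ t, q < t → ∃ j, nnratOf (g (v j, j)) < t

/-- The computation with index `n = (j, s)` shows within `s` steps that the machine `c.2` maps `x`
to `y` and that the `j`-th approximation by `c.1` at `x` is less than `k * log 2`. -/
def stageTest (g : ℕ × ℕ → ℕ × ℕ) (c : (Code × Code) × BitString) (t : BitString × ℕ) (n : ℕ) :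
    Bool :=
  decide (Code.evaln n.unpair.2 c.1.2 (Encodable.encode t.1) = some (Encodable.encode c.2)) &&
    (Code.evaln n.unpair.2 c.1.1 (Encodable.encode (t.1, n.unpair.1))).elim false fun r =>
      decide (ExpCert (g (r, n.unpair.1)) t.2 n.unpair.2)

theorem stageTest_iff {g : ℕ × ℕ → ℕ × ℕ} {c d : Code} {y x : BitString} {k n : ℕ} :
    stageTest g ((c, d), y) (x, k) n = true ↔
      Code.evaln n.unpair.2 d (Encodable.encode x) = some (Encodable.encode y) ∧
      ∃ r, Code.evaln n.unpair.2 c (Encodable.encode (x, n.unpair.1)) = some r ∧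
        ExpCert (g (r, n.unpair.1)) k n.unpair.2 := by
  unfold stageTest
  cases h : Code.evaln n.unpair.2 c (Encodable.encode (x, n.unpair.1)) <;> simp

theorem primrec_stageTest {g : ℕ × ℕ → ℕ × ℕ} (hg : Primrec g) :
    Primrec fun t : (((Code × Code) × BitString) × (BitString × ℕ)) × ℕ =>
      stageTest g t.1.1 t.1.2 t.2 := by
  let A := (((Code × Code) × BitString) × (BitString × ℕ)) × ℕ
  have hj : Primrec fun t : A => t.2.unpair.1 := Primrec.fst.comp (Primrec.unpair.comp Primrec.snd)
  have hs : Primrec fun t : A => t.2.unpair.2 := Primrec.snd.comp (Primrec.unpair.comp Primrec.snd)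
  have hc : Primrec fun t : A => t.1.1.1.1 :=
    Primrec.fst.comp (Primrec.fst.comp (Primrec.fst.comp Primrec.fst))
  have hd : Primrec fun t : A => t.1.1.1.2 :=
    Primrec.snd.comp (Primrec.fst.comp (Primrec.fst.comp Primrec.fst))
  have hy : Primrec fun t : A => t.1.1.2 := Primrec.snd.comp (Primrec.fst.comp Primrec.fst)
  have hx : Primrec fun t : A => t.1.2.1 := Primrec.fst.comp (Primrec.snd.comp Primrec.fst)
  have hk : Primrec fun t : A => t.1.2.2 := Primrec.snd.comp (Primrec.snd.comp Primrec.fst)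
  refine Primrec.and.comp (PrimrecPred.decide (Primrec.eq.comp ?_ ?_))
    ((Primrec.option_casesOn (g := fun (t : A) r =>
      decide (ExpCert (g (r, t.2.unpair.1)) t.1.2.2 t.2.unpair.2))
      (Code.primrec_evaln.comp (Primrec.pair (Primrec.pair hs hc)
        (Primrec.encode.comp (Primrec.pair hx hj)))) (Primrec.const false) ?_).of_eq ?_)
  · exact Code.primrec_evaln.comp (Primrec.pair (Primrec.pair hs hd) (Primrec.encode.comp hx))
  · exact Primrec.option_some.comp (Primrec.encode.comp hy)
  · exact (primrecPred_expCert.comp (Primrec.pair (hg.comp (Primrec.pair Primrec.snd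
      (hj.comp Primrec.fst))) (Primrec.pair (hk.comp Primrec.fst) (hs.comp Primrec.fst)))).decide
  · intro t
    cases Code.evaln t.2.unpair.2 t.1.1.1.1 (Encodable.encode (t.1.2.1, t.2.unpair.1)) <;> rfl

/-- The request of a codeword for `x` of length about `k + 1`, at the first stage that shows
`Q x < k * log 2`. -/
def stageReq (g : ℕ × ℕ → ℕ × ℕ) (c : (Code × Code) × BitString) (i : ℕ) :
    Option (BitString × ℕ) :=
  (Encodable.decode i : Option ((BitString × ℕ) × ℕ)).bind fun t =>
    if Encodable.encode t = i ∧ stageTest g c t.1 t.2 = true ∧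
      ∀ m < t.2, ¬ stageTest g c t.1 m = true
    then some (t.1.1, t.1.2 + 1) else none

theorem primrecPred_forall_lt_not {α : Type*} [Primcodable α] {T : α → ℕ → Bool}
    (hT : Primrec₂ T) : PrimrecPred fun t : α × ℕ => ∀ m < t.2, ¬ T t.1 m = true := by
  have h : PrimrecRel fun (m : ℕ) (t : α) => ¬ T t m = true :=
    PrimrecPred.not (Primrec.eq.comp (hT.comp Primrec.snd Primrec.fst) (Primrec.const true))
  exact (h.forall_mem_list.comp (Primrec.list_range.comp Primrec.snd) Primrec.fst).of_eq
    fun t => by simp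

theorem primrec_stageReq {g : ℕ × ℕ → ℕ × ℕ} (hg : Primrec g) : Primrec₂ (stageReq g) := by
  let B := (((Code × Code) × BitString) × ℕ) × ((BitString × ℕ) × ℕ)
  have hT : Primrec₂ fun (t : ((Code × Code) × BitString) × (BitString × ℕ)) (m : ℕ) =>
      stageTest g t.1 t.2 m := primrec_stageTest hg
  have hctx : Primrec fun t : B => (t.1.1, t.2.1) :=
    Primrec.pair (Primrec.fst.comp Primrec.fst) (Primrec.fst.comp Primrec.snd)
  have hn : Primrec fun t : B => t.2.2 := Primrec.snd.comp Primrec.snd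
  have h1 : PrimrecPred fun t : B => stageTest g t.1.1 t.2.1 t.2.2 = true :=
    Primrec.eq.comp (hT.comp hctx hn) (Primrec.const true)
  have h2 : PrimrecPred fun t : B => ∀ m < t.2.2, ¬ stageTest g t.1.1 t.2.1 m = true :=
    (primrecPred_forall_lt_not hT).comp (Primrec.pair hctx hn)
  have h3 : PrimrecPred fun t : B => Encodable.encode t.2 = t.1.2 :=
    Primrec.eq.comp (Primrec.encode.comp Primrec.snd) (Primrec.snd.comp Primrec.fst)
  have h4 : Primrec fun t : B => some (t.2.1.1, t.2.1.2 + 1) :=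
    Primrec.option_some.comp (Primrec.pair (Primrec.fst.comp (Primrec.fst.comp Primrec.snd))
      (Primrec.succ.comp (Primrec.snd.comp (Primrec.fst.comp Primrec.snd))))
  exact Primrec.option_bind (Primrec.decode.comp Primrec.snd)
    (Primrec.ite (h3.and (h1.and h2)) h4 (Primrec.const none)).to₂

theorem stageReq_eq_some {g : ℕ × ℕ → ℕ × ℕ} {c : (Code × Code) × BitString} {i : ℕ}
    {u : BitString × ℕ} (h : stageReq g c i = some u) :
    ∃ x k n, u = (x, k + 1) ∧ i = Encodable.encode ((x, k), n) ∧
      stageTest g c (x, k) n = true ∧ ∀ m < n, ¬ stageTest g c (x, k) m = true := by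
  obtain ⟨⟨⟨x, k⟩, n⟩, hd, h⟩ := Option.bind_eq_some_iff.1 h
  split_ifs at h with hc
  exact ⟨x, k, n, (Option.some.inj h).symm, hc.1.symm, hc.2⟩

/-- Only the first successful stage, under its canonical code, issues a request. Without this each
pair `(x, k)` would be requested again and again and the total weight would diverge. -/
theorem stageReq_injective {g : ℕ × ℕ → ℕ × ℕ} {c : (Code × Code) × BitString} {i j : ℕ}
    {u : BitString × ℕ} (hi : stageReq g c i = some u) (hj : stageReq g c j = some u) : i = j := by
  obtain ⟨x, k, n, rfl, rfl, h1, h2⟩ := stageReq_eq_some hi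
  obtain ⟨x', k', n', hu, rfl, h1', h2'⟩ := stageReq_eq_some hj
  simp only [Prod.mk.injEq, add_left_inj] at hu
  obtain ⟨rfl, rfl⟩ := hu
  rcases lt_trichotomy n n' with h | rfl | h
  · exact absurd h1 (h2' n h)
  · rfl
  · exact absurd h1' (h2 n' h)

theorem exists_stageReq {g : ℕ × ℕ → ℕ × ℕ} {c : (Code × Code) × BitString} {x : BitString}
    {k n : ℕ} (h : stageTest g c (x, k) n = true) : ∃ i, stageReq g c i = some (x, k + 1) := by
  have hex : ∃ n, stageTest g c (x, k) n = true := ⟨n, h⟩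
  refine ⟨Encodable.encode ((x, k), Nat.find hex), ?_⟩
  rw [stageReq, Encodable.encodek, Option.bind_some]
  exact if_pos ⟨rfl, Nat.find_spec hex, fun m hm => Nat.find_min hex hm⟩

/-- A finite sum of distinct powers of `1/2` is at most twice the largest one. -/
theorem sum_inv_two_pow_le (F : Finset ℕ) {t : ℝ} (ht : 0 ≤ t) (h : ∀ k ∈ F, 2 * 2⁻¹ ^ k ≤ t) :
    ∑ k ∈ F, (2⁻¹ : ℝ) ^ k ≤ t := by
  rcases F.eq_empty_or_nonempty with rfl | hF
  · simpa
  refine le_trans ?_ (h _ (F.min'_mem hF))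
  set m := F.min' hF
  have hsub : F ⊆ Finset.Ico m (F.max' hF + 1) := fun k hk =>
    Finset.mem_Ico.2 ⟨F.min'_le k hk, Nat.lt_succ_of_le (F.le_max' k hk)⟩
  refine (Finset.sum_le_sum_of_subset_of_nonneg hsub fun _ _ _ => by positivity).trans ?_
  have : ∀ N ≥ m, ∑ k ∈ Finset.Ico m N, (2⁻¹ : ℝ) ^ k = 2 * 2⁻¹ ^ m - 2 * 2⁻¹ ^ N := by
    intro N hN
    induction N, hN using Nat.le_induction with
    | base => simp
    | succ N hN ih => rw [Finset.sum_Ico_succ_top hN, ih, pow_succ]; ring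
  rw [this _ (by have := F.min'_le_max' hF; omega)]
  linarith [show (0 : ℝ) ≤ 2 * 2⁻¹ ^ (F.max' hF + 1) by positivity]

theorem two_inv_pow_le_exp {k : ℕ} {q : ℝ} (h : q ≤ k * Real.log 2) :
    (2⁻¹ : ℝ) ^ k ≤ Real.exp (-q) := by
  have : (2⁻¹ : ℝ) ^ k = Real.exp (-(k * Real.log 2)) := by
    rw [Real.exp_neg, Real.exp_nat_mul, Real.exp_log two_pos, inv_pow]
  rw [this]
  gcongr

theorem sum_exp_le_one {s : Set BitString} {Q : BitString → ℝ}
    (h : ∑' x : s, ENNReal.ofReal (Real.exp (-Q x)) ≤ 1) (F : Finset BitString)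
    (hF : ∀ x ∈ F, x ∈ s) : ∑ x ∈ F, Real.exp (-Q x) ≤ 1 := by
  have h1 : ∑ x ∈ F, ENNReal.ofReal (Real.exp (-Q x)) ≤ 1 := by
    refine le_trans ?_ h
    rw [tsum_subtype s fun x => ENNReal.ofReal (Real.exp (-Q x))]
    refine le_trans (le_of_eq (Finset.sum_congr rfl fun x hx => ?_)) (ENNReal.sum_le_tsum F)
    rw [Set.indicator_of_mem (hF x hx)]
  rw [← ENNReal.ofReal_sum_of_nonneg fun _ _ => (Real.exp_pos _).le] at h1
  exact ENNReal.ofReal_le_one.1 h1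

theorem sum_reqWeight_stageReq_le {g : ℕ × ℕ → ℕ × ℕ} {c d : Code} {y : BitString}
    {s : Set BitString} {Q : BitString → ℝ}
    (hT : ∀ x k n, stageTest g ((c, d), y) (x, k) n = true → x ∈ s ∧ Q x ≤ k * Real.log 2)
    (hQ : ∑' x : s, ENNReal.ofReal (Real.exp (-Q x)) ≤ 1) (n : ℕ) :
    ∑ i ∈ Finset.range n, reqWeight (stageReq g ((c, d), y) i) ≤ 1 := by
  classical
  set R := stageReq g ((c, d), y)
  set I : Finset (BitString × ℕ) := (Finset.range n).biUnion fun i => (R i).toFinset with hI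
  have h1 : ∑ i ∈ Finset.range n, reqWeight (R i) = ∑ u ∈ I, (2⁻¹ : ℝ) ^ u.2 := by
    rw [hI, Finset.sum_biUnion]
    · refine Finset.sum_congr rfl fun i _ => ?_
      cases R i <;> simp [reqWeight]
    · intro i _ j _ hij
      refine Finset.disjoint_left.2 fun u hu hu' => hij ?_
      exact stageReq_injective (by simpa using hu) (by simpa using hu')
  have hmem : ∀ u ∈ I, u.1 ∈ s ∧ 2 * (2⁻¹ : ℝ) ^ u.2 ≤ Real.exp (-Q u.1) := by
    intro u hu
    obtain ⟨i, -, hi⟩ := Finset.mem_biUnion.1 hu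
    obtain ⟨x, k, m, rfl, -, ht, -⟩ := stageReq_eq_some (Option.mem_toFinset.1 hi)
    obtain ⟨hx, hq⟩ := hT x k m ht
    refine ⟨hx, ?_⟩
    have : 2 * (2⁻¹ : ℝ) ^ (k + 1) = 2⁻¹ ^ k := by rw [pow_succ]; ring
    rw [this]
    exact two_inv_pow_le_exp hq
  rw [h1]
  calc ∑ u ∈ I, (2⁻¹ : ℝ) ^ u.2
      = ∑ x ∈ I.image Prod.fst, ∑ u ∈ I with u.1 = x, (2⁻¹ : ℝ) ^ u.2 :=
        (Finset.sum_fiberwise_of_maps_to (fun u hu => Finset.mem_image_of_mem _ hu) _).symm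
    _ ≤ ∑ x ∈ I.image Prod.fst, Real.exp (-Q x) := by
        refine Finset.sum_le_sum fun x _ => ?_
        -- At a fixed `x` the requested lengths are distinct, so their weights are distinct powers
        -- of `1/2`, and twice the largest is at most `exp (-Q x)`.
        have hinj : Set.InjOn Prod.snd
            ((I.filter fun u => u.1 = x : Finset _) : Set (BitString × ℕ)) := by
          intro u hu v hv huv
          simp only [Finset.coe_filter, Set.mem_ofPred_eq] at hu hv
          exact Prod.ext (hu.2.trans hv.2.symm) huv
        rw [← Finset.sum_image (f := fun k => (2⁻¹ : ℝ) ^ k) hinj]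
        refine sum_inv_two_pow_le _ (Real.exp_pos _).le fun k hk => ?_
        obtain ⟨u, hu, rfl⟩ := Finset.mem_image.1 hk
        rw [Finset.mem_filter] at hu
        rw [← hu.2]
        exact (hmem u hu.1).2
    _ ≤ 1 := by
        refine sum_exp_le_one hQ _ fun x hx => ?_
        obtain ⟨u, hu, rfl⟩ := Finset.mem_image.1 hx
        exact (hmem u hu).1

/-- Nonnegativity allows approximations to be truncated at zero and code lengths to be natural
numbers. -/
theorem nonneg_of_tsum_exp_le_one {s : Set BitString} {Q : BitString → ℝ}
    (h : ∑' x : s, ENNReal.ofReal (Real.exp (-Q x)) ≤ 1) {x : BitString} (hx : x ∈ s) :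
    0 ≤ Q x := by
  have := sum_exp_le_one h {x} (by simpa using hx)
  rw [Finset.sum_singleton, Real.exp_le_one_iff] at this
  linarith

/-- The optimality of conditional complexity among the upper-semicomputable functions that satisfy
a Kraft inequality: `D` decodes descriptions of machines for `Q` and `f`. -/
theorem condK_le_of_approxFromAbove {U : BitString → BitString →. BitString}
    (hU : IsUniversalPrefixMachine U) {D : BitString →. Code × Code} (hD : Partrec D)
    (hDp : PrefixFree {p | (D p).Dom}) {g : ℕ × ℕ → ℕ × ℕ} (hg : Primrec g) :
    ∃ C : ℕ, ∀ p c d f (Q : BitString → ℝ) y, (c, d) ∈ D p → Computes d f →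
      ∑' x : {x | y ∈ f x}, ENNReal.ofReal (Real.exp (-Q x.1)) ≤ 1 →
      (∀ x, y ∈ f x → ApproxFromAbove c g x (Q x)) →
      ∀ x, y ∈ f x → Real.log 2 * ((condK U x y : ℝ) - p.length) - C ≤ Q x := by
  obtain ⟨C, hC⟩ := exists_program_of_requests hU hD hDp (primrec_stageReq hg)
  -- One unit pays for rounding `Q x / log 2` up to `k`, the other for requesting `k + 1` instead of
  -- `k`.
  refine ⟨C + 2, fun p c d f Q y hp hd hsum happ x hx => ?_⟩
  have hT : ∀ x k n, stageTest g ((c, d), y) (x, k) n = true →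
      x ∈ {x | y ∈ f x} ∧ Q x ≤ k * Real.log 2 := by
    intro x k n h
    obtain ⟨h1, r, h2, h3⟩ := stageTest_iff.1 h
    have hy := Code.evaln_sound h1
    rw [hd x] at hy
    obtain ⟨y', hy', he⟩ := (Part.mem_map_iff _).1 hy
    obtain rfl := Encodable.encode_injective he
    obtain ⟨v, hv, hle, -⟩ := happ x hy'
    obtain rfl := Part.mem_unique (Code.evaln_sound h2) (hv _)
    exact ⟨hy', (hle _).trans h3.lt.le⟩
  have hlog : 0 < Real.log 2 := Real.log_pos one_lt_two
  have hq := nonneg_of_tsum_exp_le_one hsum hx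
  set k := ⌊Q x / Real.log 2⌋₊ + 1 with hk
  have hk1 : Q x < k * Real.log 2 := by
    rw [← div_lt_iff₀ hlog, hk]
    exact_mod_cast Nat.lt_floor_add_one _
  have hk2 : (k : ℝ) ≤ Q x / Real.log 2 + 1 := by
    rw [hk]
    push_cast
    linarith [Nat.floor_le (div_nonneg hq hlog.le)]
  obtain ⟨v, hv, -, hlt⟩ := happ x hx
  obtain ⟨j, hj⟩ := hlt _ hk1
  have hdx : Encodable.encode y ∈ d.eval (Encodable.encode x) := by
    rw [hd x]
    exact (Part.mem_map_iff _).2 ⟨y, hx, rfl⟩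
  obtain ⟨s1, hs1⟩ := Code.evaln_complete.1 hdx
  obtain ⟨s2, hs2⟩ := Code.evaln_complete.1 (hv j)
  -- A single `s` serves as step bound for both machines and as precision of the certificate.
  obtain ⟨s, hs, h1, h2⟩ := ((eventually_expCert hj).and
    ((eventually_ge_atTop s1).and (eventually_ge_atTop s2))).exists
  have htest : stageTest g ((c, d), y) (x, k) (Nat.pair j s) = true := by
    refine stageTest_iff.2 ⟨?_, v j, ?_, ?_⟩
    · simpa using Code.evaln_mono h1 hs1
    · simpa using Code.evaln_mono h2 hs2
    · simpa using hs
  obtain ⟨i, hi⟩ := exists_stageReq htest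
  obtain ⟨z, hz, hlen⟩ := hC p (c, d) y hp (sum_reqWeight_stageReq_le hT hsum) i x (k + 1) hi
  have hK : (condK U x y : ℝ) ≤ p.length + (k + 1) + C := by
    exact_mod_cast (condK_le_length hz).trans hlen
  have hlog1 : Real.log 2 ≤ 1 := by linarith [Real.log_two_lt_d9]
  have h3 : Real.log 2 * ((condK U x y : ℝ) - p.length) ≤
      Real.log 2 * (Q x / Real.log 2 + (C + 2)) := by
    gcongr
    linarith
  rw [mul_add, mul_div_cancel₀ _ hlog.ne'] at h3
  have h4 : Real.log 2 * ((C : ℝ) + 2) ≤ C + 2 := by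
    have : (0 : ℝ) ≤ (C : ℝ) + 2 := by positivity
    nlinarith
  push_cast
  linarith

/-! ### Rational upper bounds from the outputs of machines -/

/-- The nonnegative part of the integer with code `m`. -/
def intCodeToNat (m : ℕ) : ℕ := if m.bodd = true then 0 else m.div2

theorem intCodeToNat_encode (z : ℤ) : intCodeToNat (Encodable.encode z) = z.toNat := by
  cases z with
  | ofNat n =>
    have : Encodable.encode (Int.ofNat n) = 2 * n := rfl
    rw [this]
    simp [intCodeToNat, Nat.div2_val]
  | negSucc n =>
    have : Encodable.encode (Int.negSucc n) = 2 * n + 1 := rfl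
    rw [this]
    simp [intCodeToNat]

theorem primrec_intCodeToNat : Primrec intCodeToNat :=
  Primrec.ite (Primrec.eq.comp Primrec.nat_bodd (Primrec.const true)) (Primrec.const 0)
    Primrec.nat_div2

/-- The nonnegative part of the rational number with code `t.1`. -/
def ratBound (t : ℕ × ℕ) : ℕ × ℕ := (intCodeToNat t.1.unpair.1, t.1.unpair.2)

/-- The nonnegative part of the rational number with code `t.1`, plus `2 ^ (-t.2)`. -/
def ratBoundSlack (t : ℕ × ℕ) : ℕ × ℕ :=
  (intCodeToNat t.1.unpair.1 * 2 ^ t.2 + (t.1.unpair.2 + 1), (t.1.unpair.2 + 1) * 2 ^ t.2 - 1)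

theorem primrec_ratBound : Primrec ratBound :=
  Primrec.pair
    (primrec_intCodeToNat.comp (Primrec.fst.comp (Primrec.unpair.comp Primrec.fst)))
    (Primrec.snd.comp (Primrec.unpair.comp Primrec.fst))

theorem primrec_ratBoundSlack : Primrec ratBoundSlack := by
  have hd : Primrec fun t : ℕ × ℕ => t.1.unpair.2 + 1 :=
    Primrec.succ.comp (Primrec.snd.comp (Primrec.unpair.comp Primrec.fst))
  have hp : Primrec fun t : ℕ × ℕ => 2 ^ t.2 := primrec_two_pow Primrec.snd
  exact Primrec.pair (Primrec.nat_add.comp (Primrec.nat_mul.comp (primrec_intCodeToNat.comp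
    (Primrec.fst.comp (Primrec.unpair.comp Primrec.fst))) hp) hd)
    (Primrec.nat_sub.comp (Primrec.nat_mul.comp hd hp) (Primrec.const 1))

theorem nnratOf_ratBound (a : ℤ × ℕ) (n : ℕ) :
    nnratOf (ratBound (Encodable.encode a, n)) = max ((ratOf a : ℚ) : ℝ) 0 := by
  obtain ⟨z, d⟩ := a
  have h : (0 : ℝ) < (d : ℝ) + 1 := by positivity
  simp only [ratBound, Encodable.encode_prod_val, Nat.unpair_pair, intCodeToNat_encode, nnratOf,
    ratOf, Encodable.encode_nat]
  push_cast
  rw [← zero_div ((d : ℝ) + 1), max_div_div_right h.le]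
  congr 1
  exact_mod_cast Int.ofNat_toNat z

/-- The `- 1` in the second component of `ratBoundSlack` offsets the `+ 1` that `nnratOf` adds to
the denominator. -/
theorem nnratOf_ratBoundSlack (a : ℤ × ℕ) (n : ℕ) :
    nnratOf (ratBoundSlack (Encodable.encode a, n)) = max ((ratOf a : ℚ) : ℝ) 0 + 2⁻¹ ^ n := by
  rw [← nnratOf_ratBound a n]
  simp only [ratBound, ratBoundSlack, nnratOf]
  set m := intCodeToNat (Encodable.encode a).unpair.1
  set d := (Encodable.encode a).unpair.2
  rw [Nat.cast_sub (Nat.one_le_iff_ne_zero.2 (by positivity))]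
  push_cast
  rw [sub_add_cancel, inv_pow]
  field_simp

theorem UpperSemicomputes.approxFromAbove {c : Code} {Q : BitString →. ℝ}
    (h : UpperSemicomputes c Q) {x : BitString} {q : ℝ} (hq : q ∈ Q x) (hq0 : 0 ≤ q) :
    ApproxFromAbove c ratBound x q := by
  obtain ⟨a, ha, hanti, hlim⟩ := h x q hq
  refine ⟨fun j => Encodable.encode (a j), ha, fun j => ?_, fun t ht => ?_⟩
  · rw [nnratOf_ratBound]
    refine le_max_of_le_left (Antitone.le_of_tendsto (fun i j hij => ?_) hlim j)
    exact_mod_cast hanti hij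
  · obtain ⟨j, hj⟩ := (hlim.eventually_lt_const ht).exists
    exact ⟨j, by rw [nnratOf_ratBound]; exact max_lt hj (hq0.trans_lt ht)⟩

/-- A two-sided approximation may lie below the value; adding its error bound `2 ^ (-j)` makes it an
upper bound, at most `2 * 2 ^ (-j)` too large. Monotonicity is not required. -/
theorem ComputesReal.approxFromAbove {c : Code} {Q : BitString →. ℝ}
    (h : ComputesReal c Q) {x : BitString} {q : ℝ} (hq : q ∈ Q x) (hq0 : 0 ≤ q) :
    ApproxFromAbove c ratBoundSlack x q := by
  choose a ha herr using h x q hq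
  refine ⟨fun j => Encodable.encode (a j), ha, fun j => ?_, fun t ht => ?_⟩
  · rw [nnratOf_ratBoundSlack]
    have := (abs_le.1 (herr j)).1
    linarith [le_max_left ((ratOf (a j) : ℚ) : ℝ) 0]
  · obtain ⟨j, hj⟩ := exists_pow_lt_of_lt_one (half_pos (sub_pos.2 ht))
      (show (2⁻¹ : ℝ) < 1 by norm_num)
    refine ⟨j, ?_⟩
    rw [nnratOf_ratBoundSlack]
    have h1 := (abs_le.1 (herr j)).2
    have h2 : max ((ratOf (a j) : ℚ) : ℝ) 0 ≤ q + 2⁻¹ ^ j :=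
      max_le (by linarith) (by positivity)
    linarith

/-! ### Decoding descriptions -/

/-- `Nat.bits` lists the least significant digit first, `bitVal` reads the most significant first.
-/
theorem bitVal_bits_reverse (n : ℕ) : bitVal n.bits.reverse = n := by
  induction n using Nat.binaryRec' with
  | zero => simp [bitVal]
  | bit b n h ih =>
    rw [Nat.bits_append_bit n b h, List.reverse_cons, bitVal_concat, ih, Nat.bit_val]

/-- The object that the output of `U` on the program `p` describes. -/
def decodeWith (U : BitString → BitString →. BitString) (α : Type*) [Primcodable α] :
    BitString →. α :=
  fun p => (U p []).bind fun s => (Encodable.decode (bitVal s.reverse) : Option α)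

section decodeWith

variable {U : BitString → BitString →. BitString} {α : Type*} [Primcodable α]

theorem partrec_decodeWith (hU : IsUniversalPrefixMachine U) : Partrec (decodeWith U α) :=
  Partrec.bind (hU.1.1.comp Computable.id (Computable.const [])) (Computable.ofOption
    (Primrec.decode.comp (primrec_bitVal.comp (Primrec.list_reverse.comp Primrec.snd))).to_comp).to₂

theorem prefixFree_decodeWith (hU : IsUniversalPrefixMachine U) :
    PrefixFree {p | (decodeWith U α p).Dom} :=
  (hU.1.2 []).mono fun p hp => by
    obtain ⟨a, ha⟩ := Part.dom_iff_mem.1 hp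
    obtain ⟨s, hs, -⟩ := Part.mem_bind_iff.1 ha
    exact Part.dom_iff_mem.2 ⟨s, hs⟩

theorem exists_decodeWith (hU : IsUniversalPrefixMachine U) (a : α) :
    ∃ p, a ∈ decodeWith U α p ∧ p.length = plainK U (describe a) := by
  obtain ⟨p, hp, hl⟩ := exists_program_length_eq_condK hU (describe a) []
  refine ⟨p, Part.mem_bind_iff.2 ⟨_, hp, ?_⟩, hl⟩
  simp [describe, bitVal_bits_reverse]

end decodeWith

theorem exists_decodePair {U : BitString → BitString →. BitString}
    (hU : IsUniversalPrefixMachine U) (α β : Type*) [Primcodable α] [Primcodable β] :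
    ∃ D : BitString →. α × β, Partrec D ∧ PrefixFree {p | (D p).Dom} ∧
      ∀ a b, ∃ p, (a, b) ∈ D p ∧ p.length = plainK U (describe a) + plainK U (describe b) := by
  obtain ⟨M, hM, hMp, hMr⟩ := exists_prefixFree_append (partrec_decodeWith (α := α) hU)
    (prefixFree_decodeWith hU)
    (N := fun t => (decodeWith U β t.2).map fun b => (t.1.1, b))
    (Partrec.map ((partrec_decodeWith hU).comp Computable.snd)
      (Primrec.pair (Primrec.fst.comp (Primrec.fst.comp Primrec.fst)) Primrec.snd).to_comp.to₂)
    fun _ _ => prefixFree_decodeWith hU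
  refine ⟨fun p => M p [], hM.comp Computable.id (Computable.const []), hMp [], fun a b => ?_⟩
  obtain ⟨p, hp, hpl⟩ := exists_decodeWith hU a
  obtain ⟨q, hq, hql⟩ := exists_decodeWith hU b
  exact ⟨p ++ q, hMr p q [] a (a, b) hp ((Part.mem_map_iff _).2 ⟨b, hq, rfl⟩),
    by rw [List.length_append, hpl, hql]⟩

/-! ### Optimality of conditional complexity -/

section optimality

variable {U : BitString → BitString →. BitString}

theorem exists_jointK {Q : BitString →. ℝ} {f : BitString →. BitString}
    (hQ : UpperSemicomputable Q) (hf : Partrec f) : ∃ c d : Code,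
      UpperSemicomputes c Q ∧ Computes d f ∧ plainK U (describe (c, d)) = jointK U Q f := by
  obtain ⟨c, hc⟩ := hQ
  obtain ⟨d, hd⟩ := hf.exists_code
  exact Nat.sInf_mem (s := {n : ℕ | ∃ c d : Code,
    UpperSemicomputes c Q ∧ Computes d f ∧ plainK U (describe (c, d)) = n}) ⟨_, c, d, hc, hd, rfl⟩

theorem exists_funK {f : BitString →. BitString} (hf : Partrec f) :
    ∃ d : Code, Computes d f ∧ plainK U (describe d) = funK U f := by
  obtain ⟨d, hd⟩ := hf.exists_code
  exact Nat.sInf_mem (s := {n : ℕ | ∃ c : Code, Computes c f ∧ plainK U (describe c) = n})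
    ⟨_, d, hd, rfl⟩

theorem exists_realK {Q : BitString →. ℝ} (hQ : ComputableReal Q) :
    ∃ c : Code, ComputesReal c Q ∧ plainK U (describe c) = realK U Q := by
  obtain ⟨c, hc⟩ := hQ
  exact Nat.sInf_mem (s := {n : ℕ | ∃ c : Code, ComputesReal c Q ∧ plainK U (describe c) = n})
    ⟨_, c, hc, rfl⟩

theorem exists_upperK {Q : BitString →. ℝ} (hQ : UpperSemicomputable Q) :
    ∃ c : Code, UpperSemicomputes c Q ∧ plainK U (describe c) = upperK U Q := by
  obtain ⟨c, hc⟩ := hQ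
  exact Nat.sInf_mem (s := {n : ℕ | ∃ c : Code, UpperSemicomputes c Q ∧ plainK U (describe c) = n})
    ⟨_, c, hc, rfl⟩

/-- The three optimality bounds, for a function `q` that represents `Q` on the fibre over `y`. -/
theorem exists_optimality_const (hU : IsUniversalPrefixMachine U) :
    ∃ C : ℝ, ∀ (f : BitString →. BitString) (Q : BitString →. ℝ) (q : BitString → ℝ)
      (y : BitString), Partrec f → (∀ x, y ∈ f x → q x ∈ Q x) →
      ∑' x : {x | y ∈ f x}, ENNReal.ofReal (Real.exp (-q x.1)) ≤ 1 → ∀ x, y ∈ f x →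
        (UpperSemicomputable Q →
          Real.log 2 * ((condK U x y : ℝ) - (jointK U Q f : ℝ)) - C ≤ q x) ∧
        (ComputableReal Q →
          Real.log 2 * ((condK U x y : ℝ) - ((realK U Q : ℝ) + (funK U f : ℝ))) - C ≤ q x) ∧
        (UpperSemicomputable Q →
          Real.log 2 * ((condK U x y : ℝ) - ((upperK U Q : ℝ) + (funK U f : ℝ))) - C ≤ q x) := by
  obtain ⟨C₁, h₁⟩ := condK_le_of_approxFromAbove hU (partrec_decodeWith (α := Code × Code) hU)
    (prefixFree_decodeWith hU) primrec_ratBound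
  obtain ⟨D, hD, hDp, hDr⟩ := exists_decodePair hU Code Code
  obtain ⟨C₂, h₂⟩ := condK_le_of_approxFromAbove hU hD hDp primrec_ratBoundSlack
  obtain ⟨C₃, h₃⟩ := condK_le_of_approxFromAbove hU hD hDp primrec_ratBound
  refine ⟨C₁ + C₂ + C₃, fun f Q q y hf hqQ hsum x hx => ?_⟩
  have hq0 : ∀ x, y ∈ f x → 0 ≤ q x := fun x hx =>
    nonneg_of_tsum_exp_le_one (s := {x | y ∈ f x}) hsum hx
  have c₁ : (0 : ℝ) ≤ C₁ := Nat.cast_nonneg _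
  have c₂ : (0 : ℝ) ≤ C₂ := Nat.cast_nonneg _
  have c₃ : (0 : ℝ) ≤ C₃ := Nat.cast_nonneg _
  refine ⟨fun hQ => ?_, fun hQ => ?_, fun hQ => ?_⟩
  · obtain ⟨c, d, hc, hd, hK⟩ := exists_jointK (U := U) hQ hf
    obtain ⟨p, hp, hpl⟩ := exists_decodeWith hU (c, d)
    have := h₁ p c d f q y hp hd hsum
      (fun x hx => hc.approxFromAbove (hqQ x hx) (hq0 x hx)) x hx
    rw [hpl, hK] at this
    linarith
  · obtain ⟨c, hc, hcK⟩ := exists_realK (U := U) hQ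
    obtain ⟨d, hd, hdK⟩ := exists_funK (U := U) hf
    obtain ⟨p, hp, hpl⟩ := hDr c d
    have := h₂ p c d f q y hp hd hsum
      (fun x hx => hc.approxFromAbove (hqQ x hx) (hq0 x hx)) x hx
    rw [hpl, hcK, hdK] at this
    push_cast at this
    linarith
  · obtain ⟨c, hc, hcK⟩ := exists_upperK (U := U) hQ
    obtain ⟨d, hd, hdK⟩ := exists_funK (U := U) hf
    obtain ⟨p, hp, hpl⟩ := hDr c d
    have := h₃ p c d f q y hp hd hsum
      (fun x hx => hc.approxFromAbove (hqQ x hx) (hq0 x hx)) x hx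
    rw [hpl, hcK, hdK] at this
    push_cast at this
    linarith

end optimality

/-! ### The Kraft inequality for conditional complexity -/

/-- Codewords are peeled off from the left. The empty word must be excluded: `{[]}` is prefix-free
but not uniquely decodable. -/
theorem PrefixFree.uniquelyDecodable {S : Set BitString} (hS : PrefixFree S) (h0 : [] ∉ S) :
    InformationTheory.UniquelyDecodable S := by
  intro L₁
  induction L₁ with
  | nil =>
    rintro (_ | ⟨w, L₂⟩) - h₂ h
    · rfl
    · have : w = [] := (List.append_eq_nil_iff.1 h.symm).1
      exact absurd (this ▸ h₂ w (by simp)) h0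
  | cons v L₁ ih =>
    rintro (_ | ⟨w, L₂⟩) h₁ h₂ h
    · have : v = [] := (List.append_eq_nil_iff.1 h).1
      exact absurd (this ▸ h₁ v (by simp)) h0
    · rw [List.flatten_cons, List.flatten_cons] at h
      obtain ⟨rfl, -⟩ := hS.append_inj (h₁ v (by simp)) (h₂ w (by simp))
        (⟨[], by rw [List.append_nil, h]⟩ : v ++ L₁.flatten <+: w ++ L₂.flatten)
      rw [ih L₂ (fun u hu => h₁ u (by simp [hu])) (fun u hu => h₂ u (by simp [hu]))
        (List.append_cancel_left h)]

theorem PrefixFree.sum_le_one {S : Finset BitString} (hS : PrefixFree (S : Set BitString)) :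
    ∑ w ∈ S, (2⁻¹ : ℝ) ^ w.length ≤ 1 := by
  by_cases h0 : [] ∈ S
  · have : S ⊆ {[]} := fun w hw => by
      simpa using (hS [] h0 w hw List.nil_prefix).symm
    calc ∑ w ∈ S, (2⁻¹ : ℝ) ^ w.length ≤ ∑ w ∈ {([] : BitString)}, (2⁻¹ : ℝ) ^ w.length :=
          Finset.sum_le_sum_of_subset_of_nonneg this fun _ _ _ => by positivity
      _ ≤ 1 := by simp
  · simpa using InformationTheory.kraft_mcmillan_inequality (hS.uniquelyDecodable h0)

theorem sum_condK_le_one {U : BitString → BitString →. BitString}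
    (hU : IsUniversalPrefixMachine U) (F : Finset BitString) (y : BitString) :
    ∑ x ∈ F, (2⁻¹ : ℝ) ^ condK U x y ≤ 1 := by
  choose z hz hl using fun x => exists_program_length_eq_condK hU x y
  have hinj : Function.Injective z := fun a b hab => Part.mem_unique (hz a) (hab ▸ hz b)
  have hpf : PrefixFree ((F.image z : Finset BitString) : Set BitString) :=
    (hU.1.2 y).mono fun w hw => by
      obtain ⟨x, -, rfl⟩ := Finset.mem_image.1 hw
      exact Part.dom_iff_mem.2 ⟨x, hz x⟩
  have := hpf.sum_le_one
  rw [Finset.sum_image hinj.injOn] at this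
  simpa only [hl] using this

/-! ### Entropy production -/

theorem coe_shannonEntropy {α : Type*} (p : PMF α) {s : Finset α} (h : ∀ a ∉ s, p a = 0) :
    (shannonEntropy p : EReal) = ((∑ a ∈ s, Real.negMulLog (p a).toReal : ℝ) : EReal) := by
  have hnn : ∀ a ∈ s, 0 ≤ Real.negMulLog (p a).toReal := fun a _ =>
    Real.negMulLog_nonneg ENNReal.toReal_nonneg
      (ENNReal.toReal_le_of_le_ofReal zero_le_one (by simpa using p.coe_le_one a))
  rw [shannonEntropy, tsum_eq_sum (s := s) fun a ha => by simp [h a ha],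
    ← ENNReal.ofReal_sum_of_nonneg hnn, EReal.coe_ennreal_ofReal,
    max_eq_left (Finset.sum_nonneg hnn)]

theorem toReal_map_apply {α β : Type*} [DecidableEq β] (p : PMF α) {s : Finset α}
    (h : ∀ a ∉ s, p a = 0) (g : α → β) (b : β) :
    ((p.map g) b).toReal = ∑ a ∈ s with g a = b, (p a).toReal := by
  rw [PMF.map_apply, tsum_eq_sum (s := s) fun a ha => by simp [h a ha],
    ENNReal.toReal_sum fun a _ => by split_ifs <;> simp [p.apply_ne_top], Finset.sum_filter]
  refine Finset.sum_congr rfl fun a _ => ?_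
  by_cases hab : g a = b
  · simp [hab]
  · simp [hab, Ne.symm hab]

/-- Gibbs' inequality on one fibre: compare `w / W` with the subprobability `exp (-Q)`, using `log t
≤ t - 1` at `t = W * exp (-Q a) / w a`. The heat pays for the entropy that is lost when the fibre is
merged into one state. -/
theorem sum_negMulLog_le_fiber {α : Type*} (s : Finset α) (w Q : α → ℝ) (hw : ∀ a ∈ s, 0 < w a)
    (hQ : ∑ a ∈ s, Real.exp (-Q a) ≤ 1) :
    ∑ a ∈ s, Real.negMulLog (w a) ≤ Real.negMulLog (∑ a ∈ s, w a) + ∑ a ∈ s, w a * Q a := by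
  set W := ∑ a ∈ s, w a with hW
  have hterm : ∀ a ∈ s,
      w a - W * Real.exp (-Q a) ≤ -(w a * Real.log W) - Real.negMulLog (w a) + w a * Q a := by
    intro a ha
    have hwa := hw a ha
    have hWpos : 0 < W := Finset.sum_pos hw ⟨a, ha⟩
    have h := Real.log_le_sub_one_of_pos (x := W * Real.exp (-Q a) / w a) (by positivity)
    rw [Real.log_div (by positivity) hwa.ne', Real.log_mul hWpos.ne' (Real.exp_pos _).ne',
      Real.log_exp] at h
    have h2 := mul_le_mul_of_nonneg_left h hwa.le
    rw [mul_sub (w a) (_ / _), mul_div_cancel₀ _ hwa.ne'] at h2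
    rw [Real.negMulLog]
    linarith
  have h := Finset.sum_le_sum hterm
  rw [Finset.sum_sub_distrib, Finset.sum_add_distrib, Finset.sum_sub_distrib, ← Finset.mul_sum,
    Finset.sum_neg_distrib, ← Finset.sum_mul, ← hW] at h
  have hW0 : 0 ≤ W := Finset.sum_nonneg fun a ha => (hw a ha).le
  have : W * ∑ a ∈ s, Real.exp (-Q a) ≤ W := mul_le_of_le_one_right hW0 hQ
  have e : Real.negMulLog W = -(W * Real.log W) := by rw [Real.negMulLog, neg_mul]
  linarith

theorem sum_negMulLog_le {α β : Type*} [DecidableEq β] (s : Finset α) (g : α → β) (w Q : α → ℝ)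
    (hw : ∀ a ∈ s, 0 < w a) (hQ : ∀ b, ∑ a ∈ s with g a = b, Real.exp (-Q a) ≤ 1) :
    ∑ a ∈ s, Real.negMulLog (w a) ≤
      ∑ b ∈ s.image g, Real.negMulLog (∑ a ∈ s with g a = b, w a) + ∑ a ∈ s, w a * Q a := by
  have hmaps : ∀ a ∈ s, g a ∈ s.image g := fun a ha => Finset.mem_image_of_mem g ha
  rw [← Finset.sum_fiberwise_of_maps_to hmaps, ← Finset.sum_fiberwise_of_maps_to hmaps fun a =>
    w a * Q a, ← Finset.sum_add_distrib]
  exact Finset.sum_le_sum fun b _ => sum_negMulLog_le_fiber _ w Q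
    (fun a ha => hw a (Finset.mem_filter.1 ha).1) (hQ b)

namespace PhysicalProcess

variable {X : Set BitString} {P : PhysicalProcess X} {kT : ℝ}

theorem entropyProduction_eq (P : PhysicalProcess X) (kT : ℝ) (p : PMF X) {s t : Finset X}
    (hs : ∀ a ∉ s, p a = 0) (ht : ∀ a ∉ t, p.bind P.trans a = 0) :
    P.entropyProduction kT p =
      ((∑ a ∈ t, Real.negMulLog (p.bind P.trans a).toReal
        - ∑ a ∈ s, Real.negMulLog (p a).toReal
        + (∑ a ∈ s, (p a).toReal * P.heat a) / kT : ℝ) : EReal) := by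
  rw [entropyProduction, coe_shannonEntropy p hs, coe_shannonEntropy _ ht,
    tsum_eq_sum (s := s) fun a ha => by simp [hs a ha]]
  push_cast
  rfl

/-- A deterministic process obeys the second law if its heat function satisfies the Kraft
inequality on each fibre. -/
theorem obeysSecondLaw_of_deterministic {g : X → X} (hg : ∀ x, P.trans x = PMF.pure (g x))
    (hQ : ∀ (F : Finset X) (y : X), (∀ x ∈ F, g x = y) →
      ∑ x ∈ F, Real.exp (-(P.heat x / kT)) ≤ 1) : P.ObeysSecondLaw kT := by
  classical
  intro p hp
  set s := hp.toFinset
  have hs : ∀ a ∉ s, p a = 0 := fun a ha => by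
    rw [PMF.apply_eq_zero_iff]
    simpa [s] using ha
  have hmap : p.bind P.trans = p.map g := by
    rw [show P.trans = PMF.pure ∘ g from funext hg, PMF.bind_pure_comp]
  have ht : ∀ b ∉ s.image g, p.bind P.trans b = 0 := fun b hb => by
    rw [hmap, PMF.apply_eq_zero_iff, PMF.support_map]
    rintro ⟨a, ha, rfl⟩
    exact hb (Finset.mem_image_of_mem g (by simpa [s] using ha))
  rw [P.entropyProduction_eq kT p hs ht]
  have h := sum_negMulLog_le s g (fun a => (p a).toReal) (fun a => P.heat a / kT)
    (fun a ha => ENNReal.toReal_pos (by simpa [s] using ha) (p.apply_ne_top a))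
    (fun b => hQ _ b fun a ha => (Finset.mem_filter.1 ha).2)
  simp only [hmap, toReal_map_apply p hs]
  have e : (∑ a ∈ s, (p a).toReal * P.heat a) / kT = ∑ a ∈ s, (p a).toReal * (P.heat a / kT) := by
    rw [Finset.sum_div]
    exact Finset.sum_congr rfl fun a _ => mul_div_assoc _ _ _
  rw [e]
  exact_mod_cast (by linarith : (0 : ℝ) ≤ _)

/-- The heat function of a process that obeys the second law satisfies the Kraft inequality on a
set of states that are taken to one and the same state. -/
theorem ObeysSecondLaw.sum_exp_le_one (h : P.ObeysSecondLaw kT) {y : X} (F : Finset X)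
    (hF : ∀ x ∈ F, P.trans x = PMF.pure y) : ∑ x ∈ F, Real.exp (-(P.heat x / kT)) ≤ 1 := by
  classical
  rcases F.eq_empty_or_nonempty with rfl | hne
  · simp
  set Q : X → ℝ := fun x => P.heat x / kT
  set Z : ℝ := ∑ x ∈ F, Real.exp (-Q x) with hZ
  have hZpos : 0 < Z := Finset.sum_pos (fun x _ => Real.exp_pos _) hne
  -- The Gibbs distribution is the initial distribution that minimizes the entropy production on
  -- `F`.
  set w : X → ℝ := fun x => Real.exp (-Q x) / Z with hw
  have hwpos : ∀ x, 0 < w x := fun x => div_pos (Real.exp_pos _) hZpos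
  have hwsum : ∑ x ∈ F, w x = 1 := by
    rw [hw, ← Finset.sum_div, ← hZ, div_self hZpos.ne']
  let p : PMF X := PMF.ofFinset (fun x => if x ∈ F then ENNReal.ofReal (w x) else 0) F
    (by
      rw [Finset.sum_congr rfl fun x hx => if_pos hx,
        ← ENNReal.ofReal_sum_of_nonneg fun x _ => (hwpos x).le, hwsum, ENNReal.ofReal_one])
    (fun x hx => if_neg hx)
  have hs : ∀ x ∉ F, p x = 0 := fun x hx => if_neg hx
  have hpF : ∀ x ∈ F, (p x).toReal = w x := fun x hx => by
    simp only [p, PMF.ofFinset_apply, if_pos hx]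
    exact ENNReal.toReal_ofReal (hwpos x).le
  have hbind : p.bind P.trans = PMF.pure y := by
    rw [← PMF.bind_const p (PMF.pure y)]
    ext b
    rw [PMF.bind_apply, PMF.bind_apply]
    congr 1
    ext x
    by_cases hx : x ∈ F
    · rw [hF x hx]
    · rw [hs x hx, zero_mul, zero_mul]
  have hfin : p.support.Finite := F.finite_toSet.subset fun x hx => by
    by_contra hxF
    exact hx (hs x hxF)
  have h0 := h p hfin
  rw [P.entropyProduction_eq kT p hs (t := {y}) (fun b hb => by
    rw [hbind]; exact PMF.pure_apply_of_ne _ _ (by simpa using hb)), hbind] at h0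
  simp only [Finset.sum_singleton, PMF.pure_apply_self, ENNReal.toReal_one,
    Real.negMulLog_one] at h0
  have h1 : (0 : ℝ) ≤ 0 - ∑ a ∈ F, Real.negMulLog (p a).toReal
      + (∑ a ∈ F, (p a).toReal * P.heat a) / kT := by exact_mod_cast h0
  have e1 : ∑ a ∈ F, Real.negMulLog (p a).toReal = ∑ a ∈ F, w a * Q a + Real.log Z := by
    have : ∀ a ∈ F, Real.negMulLog (p a).toReal = w a * Q a + w a * Real.log Z := by
      intro a ha
      rw [hpF a ha, Real.negMulLog, hw, Real.log_div (Real.exp_pos _).ne' hZpos.ne', Real.log_exp]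
      ring
    rw [Finset.sum_congr rfl this, Finset.sum_add_distrib, ← Finset.sum_mul, hwsum, one_mul]
  have e2 : (∑ a ∈ F, (p a).toReal * P.heat a) / kT = ∑ a ∈ F, w a * Q a := by
    rw [Finset.sum_div]
    refine Finset.sum_congr rfl fun a ha => ?_
    rw [hpF a ha, mul_div_assoc]
  -- The heat terms cancel and `h1` becomes `0 ≤ -log Z`.
  rw [e1, e2] at h1
  exact (Real.log_nonpos_iff hZpos.le).1 (by linarith)

end PhysicalProcess

/-! ### Kraft inequality for realizations, and the dominating realization. -/

namespace PhysicalProcess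

variable {X : Set BitString} {P : PhysicalProcess X} {kT : ℝ} {f : BitString →. BitString}

theorem Realizes.mem_left (hP : P.Realizes f) {x y : BitString} (h : y ∈ f x) : x ∈ X :=
  (hP x y h).1

open Classical in
/-- The heat function in units of `kT`, extended by zero. -/
noncomputable def relHeat (P : PhysicalProcess X) (kT : ℝ) (x : BitString) : ℝ :=
  if hx : x ∈ X then P.heat ⟨x, hx⟩ / kT else 0

theorem relHeat_of_mem (P : PhysicalProcess X) (kT : ℝ) {x : BitString} (hx : x ∈ X) :
    P.relHeat kT x = P.heat ⟨x, hx⟩ / kT :=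
  dif_pos hx

theorem Realizes.relHeat_mem_heatOn (hP : P.Realizes f) {x y : BitString} (h : y ∈ f x) :
    P.relHeat kT x ∈ P.heatOn kT f x :=
  ⟨⟨hP.mem_left h, Part.dom_iff_mem.2 ⟨y, h⟩⟩, (P.relHeat_of_mem kT (hP.mem_left h)).symm⟩

theorem Realizes.tsum_exp_relHeat_le_one (hP : P.Realizes f) (h : P.ObeysSecondLaw kT)
    (y : BitString) :
    ∑' x : {x | y ∈ f x}, ENNReal.ofReal (Real.exp (-P.relHeat kT x.1)) ≤ 1 := by
  rw [ENNReal.tsum_eq_iSup_sum]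
  refine iSup_le fun F => ?_
  rw [← ENNReal.ofReal_sum_of_nonneg fun _ _ => (Real.exp_pos _).le, ENNReal.ofReal_le_one]
  rcases F.eq_empty_or_nonempty with rfl | ⟨x₀, -⟩
  · simp
  obtain ⟨-, hy, -⟩ := hP x₀.1 y x₀.2
  let e : {x | y ∈ f x} ↪ X := ⟨fun x => ⟨x.1, hP.mem_left x.2⟩, fun a b hab =>
    Subtype.ext (Subtype.mk.inj hab)⟩
  have := h.sum_exp_le_one (y := ⟨y, hy⟩) (F.map e) fun x hx => by
    obtain ⟨a, -, rfl⟩ := Finset.mem_map.1 hx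
    obtain ⟨_, _, ht⟩ := hP a.1 y a.2
    exact ht
  rw [Finset.sum_map] at this
  refine le_trans (le_of_eq (Finset.sum_congr rfl fun a _ => ?_)) this
  rw [P.relHeat_of_mem kT (hP.mem_left a.2)]
  rfl

/-- The dominating realization. -/
theorem exists_dominating {U : BitString → BitString →. BitString}
    (hU : IsUniversalPrefixMachine U) (hkT : 0 < kT) (hd : f.Dom ⊆ X) (hr : f.ran ⊆ X) :
    ∃ P : PhysicalProcess X, P.Realizes f ∧ P.ObeysSecondLaw kT ∧
      ∀ x y : BitString, y ∈ f x → ∀ hx : x ∈ X, P.heat ⟨x, hx⟩ = domHeat U kT x y := by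
  classical
  -- States outside the domain stay put. The heat is set to `domHeat` at `g x` on all of `X`, so
  -- Kraft for `condK` covers every fibre of `g`, including those that mix domain points with a
  -- fixed state.
  let g : X → X := fun x =>
    if h : (f x).Dom then ⟨(f x).get h, hr ⟨x.1, Part.get_mem h⟩⟩ else x
  have hg : ∀ x y : BitString, y ∈ f x → ∀ (hx : x ∈ X) (hy : y ∈ X), g ⟨x, hx⟩ = ⟨y, hy⟩ := by
    rintro x y ⟨h, rfl⟩ hx hy
    exact dif_pos h
  refine ⟨⟨fun x => PMF.pure (g x), fun x => domHeat U kT x (g x)⟩, fun x y hxy => ?_, ?_,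
    fun x y hxy hx => ?_⟩
  · have hx : x ∈ X := hd (Part.dom_iff_mem.2 ⟨y, hxy⟩)
    have hy : y ∈ X := hr ⟨x, hxy⟩
    exact ⟨hx, hy, congrArg PMF.pure (hg x y hxy hx hy)⟩
  · refine obeysSecondLaw_of_deterministic (g := g) (fun _ => rfl) fun F y hF => ?_
    have := sum_condK_le_one hU (F.map (Function.Embedding.subtype _)) y.1
    rw [Finset.sum_map] at this
    refine le_trans (Finset.sum_le_sum fun x hx => ?_) this
    change Real.exp (-(domHeat U kT x (g x) / kT)) ≤ _
    rw [hF x hx, domHeat, mul_assoc, mul_div_cancel_left₀ _ hkT.ne', mul_comm, Real.exp_neg,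
      Real.exp_nat_mul, Real.exp_log two_pos, ← inv_pow]
    rfl
  · have hy : y ∈ X := hr ⟨x, hxy⟩
    exact congrArg (fun z : X => domHeat U kT x z) (hg x y hxy hx hy)

end PhysicalProcess

/-! ### Assembly of the main theorem. -/

theorem mainTheorem1 (U : BitString → BitString →. BitString) (hU : IsUniversalPrefixMachine U) :
    ∃ C : ℝ, ∀ f : BitString →. BitString, Partrec f →
      -- the optimality bound for upper-semicomputable `Q`
      (∀ (Q : BitString →. ℝ) (hdom : f.Dom ⊆ Q.Dom), UpperSemicomputable Q →
        (∀ y ∈ f.ran,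
          ∑' x : {x : BitString // y ∈ f x},
            ENNReal.ofReal
              (Real.exp (-(Q x.1).get (hdom (Part.dom_iff_mem.2 ⟨y, x.2⟩)))) ≤ 1) →
        ∀ x y : BitString, y ∈ f x → ∀ q ∈ Q x,
          Real.log 2 * ((condK U x y : ℝ) - (jointK U Q f : ℝ)) - C ≤ q) ∧
      -- the dominating realization exists
      (∀ (kT : ℝ), 0 < kT → ∀ X : Set BitString, f.Dom ⊆ X → f.ran ⊆ X →
        ∃ P : PhysicalProcess X, P.Realizes f ∧ P.ObeysSecondLaw kT ∧
          ∀ x y : BitString, y ∈ f x → ∀ hx : x ∈ X, P.heat ⟨x, hx⟩ = domHeat U kT x y) ∧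
      -- the heat-complexity tradeoff for every realization
      (∀ (kT : ℝ), 0 < kT → ∀ (X : Set BitString) (P : PhysicalProcess X),
        P.Realizes f → P.ObeysSecondLaw kT →
        (ComputableReal (P.heatOn kT f) →
          ∀ x y : BitString, y ∈ f x → ∀ hx : x ∈ X,
            domHeat U kT x y
              - kT * Real.log 2 * ((realK U (P.heatOn kT f) : ℝ) + (funK U f : ℝ))
              - kT * C ≤ P.heat ⟨x, hx⟩) ∧
        (UpperSemicomputable (P.heatOn kT f) →
          ∀ x y : BitString, y ∈ f x → ∀ hx : x ∈ X,
            domHeat U kT x y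
              - kT * Real.log 2 * ((upperK U (P.heatOn kT f) : ℝ) + (funK U f : ℝ))
              - kT * C ≤ P.heat ⟨x, hx⟩)) := by
  classical
  obtain ⟨C, hC⟩ := exists_optimality_const hU
  refine ⟨C, fun f hf => ⟨fun Q hdom hQ hsum x y hxy q hq => ?_,
    fun kT hkT X hd hr => PhysicalProcess.exists_dominating hU hkT hd hr,
    fun kT hkT X P hP hlaw => ?_⟩⟩
  · let q' : BitString → ℝ := fun x => if h : (Q x).Dom then (Q x).get h else 0
    have hQd : ∀ x, y ∈ f x → (Q x).Dom := fun x hx => hdom (Part.dom_iff_mem.2 ⟨y, hx⟩)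
    have hget : ∀ x (hx : y ∈ f x), q' x = (Q x).get (hQd x hx) := fun x hx => dif_pos (hQd x hx)
    have hq' : ∀ x, y ∈ f x → q' x ∈ Q x := fun x hx => by
      rw [hget x hx]
      exact Part.get_mem _
    rw [Part.mem_unique hq (hq' x hxy)]
    refine (hC f Q q' y hf hq' ?_ x hxy).1 hQ
    refine le_trans (le_of_eq (tsum_congr fun a => ?_)) (hsum y ⟨x, hxy⟩)
    rw [hget a.1 a.2]
  -- Multiplying the dimensionless bound by `kT` restores the units of heat.
  · have key : ∀ x y K : _, y ∈ f x → ∀ hx : x ∈ X,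
        Real.log 2 * ((condK U x y : ℝ) - K) - C ≤ P.relHeat kT x →
        domHeat U kT x y - kT * Real.log 2 * K - kT * C ≤ P.heat ⟨x, hx⟩ := by
      intro x y K hxy hx h
      rw [P.relHeat_of_mem kT hx, le_div_iff₀ hkT] at h
      rw [domHeat]
      linarith
    have hmain := fun x y hxy => hC f (P.heatOn kT f) (P.relHeat kT) y hf
      (fun x hx => hP.relHeat_mem_heatOn hx) (hP.tsum_exp_relHeat_le_one hlaw y) x hxy
    exact ⟨fun hQ x y hxy hx => key x y _ hxy hx ((hmain x y hxy).2.1 hQ),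
      fun hQ x y hxy hx => key x y _ hxy hx ((hmain x y hxy).2.2 hQ)⟩
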